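/- **Corollary (product of free groups).** Let $F_1$ and $F_2$ be finitely generated free groups. Then the group $F_1\times F_2$ is systolic. More precisely, there are simplicial trees $T_1$ and $T_2$, with an action of $F_1$ on $T_1$ and an action of $F_2$ on $T_2$ by graph automorphisms, such that the simplexification $(T_1\times T_2)^*$ is a systolic complex and the action of $F_1\times F_2$ on $(T_1\times T_2)^*$ induced by the product action is geometric. Here a simplicial complex is *systolic* if its geometric realisation is connected and simply connected and if the link of each of its vertices is flag and contains no cycle of length $4$ or $5$ without diagonals. An action of a discrete group on a simplicial complex by simplicial automorphisms is *geometric* if it is properly discontinuous and cocompact on the geometric realisation, and a group is *systolic* if it admits a geometric action on some systolic complex. Regard $T_1\times T_2$ as a square complex with vertices $(a,b)$, horizontal edges $(e,b)$, vertical edges $(a,f)$ and squares $(e,f)$, where $a,b$ are vertices and $e,f$ are edges of $T_1,T_2$ respectively. Its *simplexification* $(T_1\times T_2)^*$ is the simplicial complex having one vertex $v^*$, $g^*$, $s^*$ for each vertex $v$, each vertical edge $g$ and each square $s$, whose simplices are the nonempty finite subsets of the following sets: - $\{v^*\}$ for each vertex $v$; - $\{v^*,w^*\}$ for each horizontal edge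 with endpoints $v,w$; - $\{v^*,w^*,s^*\}$ for each square $s$ and each horizontal edge of $s$ with endpoints $v,w$; - $\{v^*,g^*\}\cup\{s^* : s \text{ a square adjacent to } g\}$ for each vertical edge $g$ and each endpoint $v$ of $g$. -/

import Mathlib

universe u v

/-! ### Simplicial complexes: flagness, links, realisation, automorphisms -/

namespace PreAbstractSimplicialComplex

variable {V : Type u}

/-- The graph formed by the edges of a simplicial complex: two distinct vertices are adjacent when
some simplex contains both of them (equivalently, when they span an edge). -/
def oneSkeleton (L : PreAbstractSimplicialComplex V) : SimpleGraph V where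
  Adj a b := a ≠ b ∧ ∃ s ∈ L.faces, a ∈ s ∧ b ∈ s
  symm := ⟨fun _ _ h => ⟨h.1.symm, h.2.imp fun _ hs => ⟨hs.1, hs.2.2, hs.2.1⟩⟩⟩
  loopless := ⟨fun _ h => h.1 rfl⟩

/-- A complex is flag if every nonempty finite set of its vertices which are pairwise joined by
edges spans a simplex. (`V` may contain elements which are not vertices of `L`.) -/
def IsFlag (L : PreAbstractSimplicialComplex V) : Prop :=
  ∀ s : Finset V, s.Nonempty → (∀ a ∈ s, {a} ∈ L.faces) →
    (∀ a ∈ s, ∀ b ∈ s, a ≠ b → L.oneSkeleton.Adj a b) → s ∈ L.faces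

/-- A cycle of length `n ≥ 4` without diagonals: an embedded copy of the `n`-cycle in the
1-skeleton such that non-consecutive vertices are not joined by an edge, i.e. an induced `n`-cycle. -/
def HasCycleWithoutDiagonals (L : PreAbstractSimplicialComplex V) (n : ℕ) : Prop :=
  Nonempty (SimpleGraph.cycleGraph n ↪g L.oneSkeleton)

end PreAbstractSimplicialComplex

namespace AbstractSimplicialComplex

variable {V : Type u}

/-- The link of a vertex `v`: all nonempty `s` not containing `v` such that `s ∪ {v}` is a
simplex. -/
def link (K : AbstractSimplicialComplex V) (v : V) : PreAbstractSimplicialComplex V where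
  faces := {s | s.Nonempty ∧ ∃ h : v ∉ s, s.cons v h ∈ K.faces}
  isRelLowerSet_faces := by
    rintro s ⟨hs, hv, hK⟩
    refine ⟨hs, fun t hts ht => ⟨ht, fun h => hv (hts h), ?_⟩⟩
    exact (K.isRelLowerSet_faces hK).2 (Finset.cons_subset_cons.2 hts) (Finset.cons_nonempty _)

/-- Local 6-largeness: all vertex links are flag and contain no cycle of length 4 or 5 without
diagonals. -/
def IsLocallySixLarge (K : AbstractSimplicialComplex V) : Prop :=
  ∀ v : V, (K.link v).IsFlag ∧ ¬ (K.link v).HasCycleWithoutDiagonals 4 ∧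
    ¬ (K.link v).HasCycleWithoutDiagonals 5

/-- The closed affine simplex with vertex set `s`, in barycentric coordinates. -/
def closedSimplex (s : Finset V) : Set (V → ℝ) :=
  {x | (∀ v, 0 ≤ x v) ∧ (∀ v, v ∉ s → x v = 0) ∧ ∑ v ∈ s, x v = 1}

/-- The geometric realisation, as a set: the union of the closed simplices spanned by the faces. -/
def Realization (K : AbstractSimplicialComplex V) : Type u :=
  {x : V → ℝ // ∃ s ∈ K.faces, x ∈ closedSimplex s}

/-- The inclusion of a closed simplex in the geometric realisation. -/
def simplexInclusion (K : AbstractSimplicialComplex V) (s : K.faces)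
    (x : closedSimplex (s : Finset V)) : K.Realization :=
  ⟨x.1, s.1, s.2, x.2⟩

/-- The weak topology: the realisation is the topological quotient of the disjoint union of its
closed simplices (each with its Euclidean topology), that is, a set is open if and only if its
trace on every closed simplex is open there. -/
instance (K : AbstractSimplicialComplex V) : TopologicalSpace K.Realization :=
  ⨆ s : K.faces, TopologicalSpace.coinduced (K.simplexInclusion s) inferInstance

/-- A complex is systolic if it is connected, simply connected and locally 6-large.
(In Mathlib a `SimplyConnectedSpace` is nonempty and path connected.) -/
def IsSystolic (K : AbstractSimplicialComplex V) : Prop :=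
  SimplyConnectedSpace K.Realization ∧ K.IsLocallySixLarge

/-- The group of simplicial automorphisms. -/
def autGroup (K : AbstractSimplicialComplex V) : Subgroup (Equiv.Perm V) where
  carrier := {φ | ∀ s : Finset V, s.map φ.toEmbedding ∈ K.faces ↔ s ∈ K.faces}
  one_mem' := fun s => by
    have : s.map (1 : Equiv.Perm V).toEmbedding = s := Finset.map_refl
    rw [this]
  mul_mem' := fun {φ ψ} hφ hψ s => by
    have : s.map (φ * ψ).toEmbedding = (s.map ψ.toEmbedding).map φ.toEmbedding := by
      rw [Finset.map_map]; rfl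
    rw [this, hφ, hψ]
  inv_mem' := fun {φ} hφ s => by
    have : (s.map (φ⁻¹).toEmbedding).map φ.toEmbedding = s := by
      rw [Finset.map_map]; ext; simp
    rw [← hφ, this]

/-- Simplicial automorphisms act on the geometric realisation, affinely on each simplex: the
coordinate of `φ • x` at the vertex `φ v` is the coordinate of `x` at `v`. -/
instance (K : AbstractSimplicialComplex V) : MulAction K.autGroup K.Realization where
  smul φ x := ⟨fun v => x.1 ((φ : Equiv.Perm V)⁻¹ v), by
    obtain ⟨s, hs, h0, h1, h2⟩ := x.2
    refine ⟨s.map (φ : Equiv.Perm V).toEmbedding, (φ.2 s).2 hs, fun v => h0 _, fun v hv => ?_, ?_⟩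
    · refine h1 _ fun h => hv ?_
      exact Finset.mem_map.2 ⟨_, h, by simp⟩
    · rw [Finset.sum_map]; simpa using h2⟩
  one_smul _ := rfl
  mul_smul _ _ _ := rfl

/-- An action of a (discrete) group by simplicial automorphisms is geometric if, on the geometric
realisation, it is properly discontinuous and cocompact. -/
def IsGeometricAction {G : Type v} [Group G] (K : AbstractSimplicialComplex V)
    (ρ : G →* K.autGroup) : Prop :=
  (∀ C : Set K.Realization, IsCompact C → {g : G | ((ρ g • ·) '' C ∩ C).Nonempty}.Finite) ∧
    ∃ C : Set K.Realization, IsCompact C ∧ ∀ x, ∃ g : G, ∃ y ∈ C, ρ g • y = x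

end AbstractSimplicialComplex

/-- A group is systolic if it admits a geometric action by simplicial automorphisms on a systolic
complex. -/
def IsSystolicGroup (G : Type u) [Group G] : Prop :=
  ∃ (V : Type u) (K : AbstractSimplicialComplex V), K.IsSystolic ∧
    ∃ ρ : G →* K.autGroup, K.IsGeometricAction ρ

/-! ### The simplexification of a product of two trees

The product of the graphs `T₁` and `T₂` is the square complex with vertices `(a, b)`, horizontal
edges `(e, b)`, vertical edges `(a, f)` and squares `(e, f)`, where `a`, `b` are vertices and `e`,
`f` are edges of `T₁`, `T₂`. -/

section Simplexification

variable {α : Type u} {β : Type v}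

/-- The vertices `v*`, `e*`, `s*` of the simplexification, one for each vertex `v`, each vertical
edge `e` and each square `s` of the product of `T₁` and `T₂`. -/
inductive SimplexificationVertex (T₁ : SimpleGraph α) (T₂ : SimpleGraph β) : Type (max u v)
  | vertex (a : α) (b : β)
  | verticalEdge (a : α) (f : T₂.edgeSet)
  | square (e : T₁.edgeSet) (f : T₂.edgeSet)

namespace SimplexificationVertex

variable {T₁ : SimpleGraph α} {T₂ : SimpleGraph β}

/-- The two endpoints of the horizontal edge `(e, b)`. -/
def horizontalEdgeSimplex (e : T₁.edgeSet) (b : β) : Set (SimplexificationVertex T₁ T₂) :=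
  {c | ∃ a ∈ (e : Sym2 α), c = vertex a b}

/-- The triangle spanned by the centre of the square `(e, f)` and its horizontal edge `(e, b)`,
where `b ∈ f`. -/
def triangleSimplex (e : T₁.edgeSet) (f : T₂.edgeSet) (b : β) :
    Set (SimplexificationVertex T₁ T₂) :=
  insert (square e f) (horizontalEdgeSimplex e b)

/-- The simplex spanned by the endpoint `(a, b)` of the vertical edge `(a, f)`, where `b ∈ f`, by
the midpoint of this edge and by the centres of all the squares adjacent to this edge. -/
def verticalEdgeSimplex (a : α) (f : T₂.edgeSet) (b : β) : Set (SimplexificationVertex T₁ T₂) :=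
  {vertex a b, verticalEdge a f} ∪ {c | ∃ e : T₁.edgeSet, a ∈ (e : Sym2 α) ∧ c = square e f}

/-- The bijection of the vertices induced by automorphisms of the two factors. -/
def map (φ : (T₁ ≃g T₁) × (T₂ ≃g T₂)) :
    SimplexificationVertex T₁ T₂ → SimplexificationVertex T₁ T₂
  | vertex a b => vertex (φ.1 a) (φ.2 b)
  | verticalEdge a f => verticalEdge (φ.1 a) (φ.2.mapEdgeSet f)
  | square e f => square (φ.1.mapEdgeSet e) (φ.2.mapEdgeSet f)

theorem map_one (c : SimplexificationVertex T₁ T₂) : map 1 c = c := by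
  have h₁ : ∀ e : T₁.edgeSet, (1 : T₁ ≃g T₁).mapEdgeSet e = e := fun e =>
    Subtype.ext (Sym2.map_id' ▸ rfl : Sym2.map (fun x => x) (e : Sym2 α) = e)
  have h₂ : ∀ e : T₂.edgeSet, (1 : T₂ ≃g T₂).mapEdgeSet e = e := fun e =>
    Subtype.ext (Sym2.map_id' ▸ rfl : Sym2.map (fun x => x) (e : Sym2 β) = e)
  cases c <;> simp [map, h₁, h₂]

theorem map_mul (φ ψ : (T₁ ≃g T₁) × (T₂ ≃g T₂)) (c : SimplexificationVertex T₁ T₂) :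
    map (φ * ψ) c = map φ (map ψ c) := by
  have h₁ : ∀ e : T₁.edgeSet, (φ.1 * ψ.1).mapEdgeSet e = φ.1.mapEdgeSet (ψ.1.mapEdgeSet e) :=
    fun e => Subtype.ext (Sym2.map_map (g := φ.1) (f := ψ.1) (e : Sym2 α)).symm
  have h₂ : ∀ e : T₂.edgeSet, (φ.2 * ψ.2).mapEdgeSet e = φ.2.mapEdgeSet (ψ.2.mapEdgeSet e) :=
    fun e => Subtype.ext (Sym2.map_map (g := φ.2) (f := ψ.2) (e : Sym2 β)).symm
  cases c <;> simp [map, h₁, h₂]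

/-- The permutation action of automorphisms of the two factors on the vertices. -/
def mapPerm : (T₁ ≃g T₁) × (T₂ ≃g T₂) →* Equiv.Perm (SimplexificationVertex T₁ T₂) where
  toFun φ := ⟨map φ, map φ⁻¹, fun c => by rw [← map_mul, inv_mul_cancel, map_one],
    fun c => by rw [← map_mul, mul_inv_cancel, map_one]⟩
  map_one' := Equiv.ext map_one
  map_mul' φ ψ := Equiv.ext (map_mul φ ψ)

end SimplexificationVertex

open SimplexificationVertex in
/-- The simplexification of the product of `T₁` (horizontal factor) and `T₂` (vertical factor).
Every vertical edge is halved and every square is divided into six triangles by joining its centre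
to its corners and to the midpoints of its vertical edges; then, for every vertical edge and each of
its endpoints, a simplex spanned by this endpoint, the midpoint of the edge and the centres of all
squares adjacent to the edge is attached. (It contains the triangles adjacent to the halves of
vertical edges.) -/
def simplexification (T₁ : SimpleGraph α) (T₂ : SimpleGraph β) :
    AbstractSimplicialComplex (SimplexificationVertex T₁ T₂) where
  faces := {s | s.Nonempty ∧
    ((∃ a b, (s : Set (SimplexificationVertex T₁ T₂)) ⊆ {vertex a b}) ∨
     (∃ e b, (s : Set (SimplexificationVertex T₁ T₂)) ⊆ horizontalEdgeSimplex e b) ∨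
     (∃ (e : T₁.edgeSet) (f : T₂.edgeSet), ∃ b ∈ (f : Sym2 β),
        (s : Set (SimplexificationVertex T₁ T₂)) ⊆ triangleSimplex e f b) ∨
     (∃ (a : α) (f : T₂.edgeSet), ∃ b ∈ (f : Sym2 β),
        (s : Set (SimplexificationVertex T₁ T₂)) ⊆ verticalEdgeSimplex a f b))}
  isRelLowerSet_faces := by
    rintro s ⟨hs, h⟩
    refine ⟨hs, fun t hts ht => ⟨ht, ?_⟩⟩
    have hts' : (t : Set (SimplexificationVertex T₁ T₂)) ⊆ s := Finset.coe_subset.2 hts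
    rcases h with ⟨a, b, h⟩ | ⟨e, b, h⟩ | ⟨e, f, b, hb, h⟩ | ⟨a, f, b, hb, h⟩
    · exact Or.inl ⟨a, b, hts'.trans h⟩
    · exact Or.inr (Or.inl ⟨e, b, hts'.trans h⟩)
    · exact Or.inr (Or.inr (Or.inl ⟨e, f, b, hb, hts'.trans h⟩))
    · exact Or.inr (Or.inr (Or.inr ⟨a, f, b, hb, hts'.trans h⟩))
  singleton_mem c := by
    refine ⟨Finset.singleton_nonempty c, ?_⟩
    rw [Finset.coe_singleton]
    cases c with
    | vertex a b => exact Or.inl ⟨a, b, subset_rfl⟩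
    | verticalEdge a f =>
      refine Or.inr (Or.inr (Or.inr ⟨a, f, _, Sym2.out_fst_mem (f : Sym2 β), ?_⟩))
      simp [verticalEdgeSimplex]
    | square e f =>
      refine Or.inr (Or.inr (Or.inl ⟨e, f, _, Sym2.out_fst_mem (f : Sym2 β), ?_⟩))
      simp [triangleSimplex]

namespace SimplexificationVertex

variable {T₁ : SimpleGraph α} {T₂ : SimpleGraph β}

theorem map_mem_faces (φ : (T₁ ≃g T₁) × (T₂ ≃g T₂)) {s : Finset (SimplexificationVertex T₁ T₂)}
    (hs : s ∈ (simplexification T₁ T₂).faces) :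
    s.map (mapPerm φ).toEmbedding ∈ (simplexification T₁ T₂).faces := by
  have key : ∀ A B : Set (SimplexificationVertex T₁ T₂), (∀ c ∈ A, map φ c ∈ B) →
      (s : Set (SimplexificationVertex T₁ T₂)) ⊆ A →
      ((s.map (mapPerm φ).toEmbedding : Finset _) : Set (SimplexificationVertex T₁ T₂)) ⊆ B := by
    intro A B hAB hsA c hc
    obtain ⟨d, hd, rfl⟩ := Finset.mem_map.1 (Finset.mem_coe.1 hc)
    exact hAB d (hsA hd)
  have hm₁ : ∀ (e : T₁.edgeSet) a, a ∈ (e : Sym2 α) → φ.1 a ∈ (φ.1.mapEdgeSet e : Sym2 α) :=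
    fun e a h => Sym2.mem_map.2 ⟨a, h, rfl⟩
  have hm₂ : ∀ (f : T₂.edgeSet) b, b ∈ (f : Sym2 β) → φ.2 b ∈ (φ.2.mapEdgeSet f : Sym2 β) :=
    fun e a h => Sym2.mem_map.2 ⟨a, h, rfl⟩
  obtain ⟨hne, h⟩ := hs
  refine ⟨hne.map, ?_⟩
  rcases h with ⟨a, b, h⟩ | ⟨e, b, h⟩ | ⟨e, f, b, hb, h⟩ | ⟨a, f, b, hb, h⟩
  · refine Or.inl ⟨φ.1 a, φ.2 b, key _ _ ?_ h⟩
    rintro _ rfl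
    rfl
  · refine Or.inr (Or.inl ⟨φ.1.mapEdgeSet e, φ.2 b, key _ _ ?_ h⟩)
    rintro _ ⟨a, ha, rfl⟩
    exact ⟨_, hm₁ e a ha, rfl⟩
  · refine Or.inr (Or.inr (Or.inl
      ⟨φ.1.mapEdgeSet e, φ.2.mapEdgeSet f, φ.2 b, hm₂ f b hb, key _ _ ?_ h⟩))
    rintro _ (rfl | ⟨a, ha, rfl⟩)
    · exact Or.inl rfl
    · exact Or.inr ⟨_, hm₁ e a ha, rfl⟩
  · refine Or.inr (Or.inr (Or.inr ⟨φ.1 a, φ.2.mapEdgeSet f, φ.2 b, hm₂ f b hb, key _ _ ?_ h⟩))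
    rintro _ ((rfl | rfl) | ⟨e, he, rfl⟩)
    · exact Or.inl (Or.inl rfl)
    · exact Or.inl (Or.inr rfl)
    · exact Or.inr ⟨_, hm₁ e a he, rfl⟩

end SimplexificationVertex

/-- The action on the simplexification induced by automorphisms of the two factors. -/
def simplexificationAut (T₁ : SimpleGraph α) (T₂ : SimpleGraph β) :
    (T₁ ≃g T₁) × (T₂ ≃g T₂) →* (simplexification T₁ T₂).autGroup :=
  SimplexificationVertex.mapPerm.codRestrict _ fun φ s => by
    refine ⟨fun h => ?_, SimplexificationVertex.map_mem_faces φ⟩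
    have h' := SimplexificationVertex.map_mem_faces φ⁻¹ h
    have : (s.map (SimplexificationVertex.mapPerm φ).toEmbedding).map
        (SimplexificationVertex.mapPerm φ⁻¹).toEmbedding = s := by
      rw [Finset.map_map]; ext; simp
    rwa [this] at h'

end Simplexification

/-!
The trees are the Cayley graphs of the two free groups with respect to finite bases. A reduced word
acquires a parent by deleting its last letter, so these graphs are rooted trees; they are locally
finite, and the groups act on them by left multiplication, simply transitively on the vertices.

*Simple connectedness.* For a locally finite complex the weak topology on the realisation is that of
pointwise convergence of barycentric coordinates (`IsLocallyFinite.isEmbedding_val`), so a vertex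
map under which every face spans a common face with its image is homotopic to the identity by
straight lines
(`IsLocallyFinite.contractibleSpace_supportedOn`). Over the balls of radii `N`, `M` about the two
roots, the simplexification can therefore be contracted leaf by leaf. Over the leaves of the
horizontal tree, the midpoints of vertical edges move to the centres of the adjacent squares, then
the vertices move to their horizontal neighbours, then the centres of the squares move to the
opposite vertical edges (`contractibleSpace_depthBox_succ_left`); when the horizontal tree is a
point, what is left is a subdivided tree (`contractibleSpace_depthBox_succ_right`). By compactness
every path lies over such balls, so the whole complex is simply connected.

*Local 6-largeness.* As trees have no triangles, the simplexification is flag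
(`exists_cell_of_pairwise_near`), hence so are its links. In each link there is a set of vertices
which meets every induced cycle of length at least four in exactly every third vertex (the original
vertices in the link of an original vertex, the other ones in the remaining links), so the length of
such a cycle is divisible by three (`SimpleGraph.not_cycleGraph_embedding_of_period_three`).

*Geometricity.* A compact subset of the realisation is supported on finitely many vertices, and a
group element carrying one such vertex to another is determined up to finitely many choices by its
action on the underlying vertices of the trees; finitely many orbits of vertices and local
finiteness give cocompactness (`isGeometricAction`).
-/

/-! ### Realisations of locally finite complexes -/

namespace AbstractSimplicialComplex

variable {V : Type u}

/-- Every vertex lies in only finitely many faces. -/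
def IsLocallyFinite (K : AbstractSimplicialComplex V) : Prop :=
  ∀ v : V, {s | s ∈ K.faces ∧ v ∈ s}.Finite

theorem continuous_simplexInclusion (K : AbstractSimplicialComplex V) (s : K.faces) :
    Continuous (K.simplexInclusion s) :=
  continuous_iSup_rng (i := s) continuous_coinduced_rng

theorem isClosed_closedSimplex (s : Finset V) : IsClosed (closedSimplex s) := by
  have h : closedSimplex s = (⋂ v, {x : V → ℝ | 0 ≤ x v}) ∩
      ((⋂ v, ⋂ (_ : v ∉ s), {x : V → ℝ | x v = 0}) ∩ {x : V → ℝ | ∑ v ∈ s, x v = 1}) := by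
    ext x; simp [closedSimplex]
  rw [h]
  refine (isClosed_iInter fun v => isClosed_le continuous_const (continuous_apply v)).inter
    ((isClosed_iInter fun v => isClosed_iInter fun _ =>
      isClosed_eq (continuous_apply v) continuous_const).inter
      (isClosed_eq (continuous_finsetSum _ fun v _ => continuous_apply v) continuous_const))

theorem isCompact_closedSimplex (s : Finset V) : IsCompact (closedSimplex s) := by
  refine (isCompact_univ_pi fun _ : V => isCompact_Icc (a := (0 : ℝ)) (b := 1)).of_isClosed_subset
    (isClosed_closedSimplex s) ?_
  rintro x ⟨h0, h1, h2⟩ v -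
  refine ⟨h0 v, ?_⟩
  by_cases hv : v ∈ s
  · rw [← h2]
    exact Finset.single_le_sum (fun u _ => h0 u) hv
  · rw [h1 v hv]
    exact zero_le_one

theorem exists_pos_of_mem_closedSimplex {s : Finset V} {x : V → ℝ} (hx : x ∈ closedSimplex s) :
    ∃ v, 0 < x v := by
  by_contra! h
  have : ∑ v ∈ s, x v ≤ 0 := Finset.sum_nonpos fun v _ => h v
  linarith [hx.2.2]

theorem mem_of_mem_closedSimplex {s : Finset V} {x : V → ℝ} (hx : x ∈ closedSimplex s) {v : V}
    (hv : x v ≠ 0) : v ∈ s := by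
  by_contra h
  exact hv (hx.2.1 v h)

theorem closedSimplex_mono {s t : Finset V} (h : s ⊆ t) : closedSimplex s ⊆ closedSimplex t := by
  rintro x ⟨h0, h1, h2⟩
  refine ⟨h0, fun v hv => h1 v fun h' => hv (h h'), ?_⟩
  rw [← h2]
  exact (Finset.sum_subset h fun v _ hv => h1 v hv).symm

theorem convex_closedSimplex (s : Finset V) : Convex ℝ (closedSimplex s) := by
  rintro x ⟨hx0, hx1, hx2⟩ y ⟨hy0, hy1, hy2⟩ a b ha hb hab
  refine ⟨fun v => ?_, fun v hv => ?_, ?_⟩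
  · have := hx0 v
    have := hy0 v
    simp only [Pi.add_apply, Pi.smul_apply, smul_eq_mul]
    positivity
  · simp [hx1 v hv, hy1 v hv]
  · simp only [Pi.add_apply, Pi.smul_apply, smul_eq_mul, Finset.sum_add_distrib,
      ← Finset.mul_sum, hx2, hy2, mul_one, hab]

/-- A point of a closed simplex lies in the closed simplex spanned by its support. -/
theorem exists_face_support (K : AbstractSimplicialComplex V) (x : K.Realization) :
    ∃ s ∈ K.faces, x.1 ∈ closedSimplex s ∧ ∀ v ∈ s, x.1 v ≠ 0 := by
  classical
  obtain ⟨s, hs, hx⟩ := x.2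
  obtain ⟨v, hv⟩ := exists_pos_of_mem_closedSimplex hx
  refine ⟨s.filter fun v => x.1 v ≠ 0, (K.isRelLowerSet_faces hs).2 (Finset.filter_subset _ _)
    ⟨v, Finset.mem_filter.2 ⟨mem_of_mem_closedSimplex hx hv.ne', hv.ne'⟩⟩,
    ⟨hx.1, fun v hv => ?_, ?_⟩, fun v hv => (Finset.mem_filter.1 hv).2⟩
  · by_contra h
    exact hv (Finset.mem_filter.2 ⟨mem_of_mem_closedSimplex hx h, h⟩)
  · rw [Finset.sum_filter_ne_zero, hx.2.2]

theorem continuous_val (K : AbstractSimplicialComplex V) :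
    Continuous (fun x : K.Realization => x.1) :=
  continuous_iSup_dom.2 fun _ => continuous_coinduced_dom.2 continuous_subtype_val

/-- For a locally finite complex the weak topology on the realisation is the topology of pointwise
convergence of barycentric coordinates, because the closed simplices form a locally finite closed
cover for the latter. -/
theorem IsLocallyFinite.isEmbedding_val {K : AbstractSimplicialComplex V} (hK : K.IsLocallyFinite) :
    Topology.IsEmbedding (fun x : K.Realization => x.1) := by
  let X := {x : V → ℝ // ∃ s ∈ K.faces, x ∈ closedSimplex s}
  have hid : Continuous (fun x : X => (show K.Realization from x)) := by
    refine LocallyFinite.continuous (f := fun s : K.faces => {x : X | x.1 ∈ closedSimplex s.1})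
      (fun x => ?_) ?_ (fun s => (isClosed_closedSimplex _).preimage continuous_subtype_val)
      fun s => ?_
    · obtain ⟨s, hs, hx⟩ := x.2
      obtain ⟨v, hv⟩ := exists_pos_of_mem_closedSimplex hx
      refine ⟨{y : X | 0 < y.1 v}, (isOpen_lt continuous_const
        ((continuous_apply v).comp continuous_subtype_val)).mem_nhds hv, ?_⟩
      refine ((hK v).preimage Subtype.val_injective.injOn).subset ?_
      rintro t ⟨y, hy, hy'⟩
      exact ⟨t.2, mem_of_mem_closedSimplex hy (ne_of_gt hy')⟩
    · refine Set.eq_univ_of_forall fun x => ?_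
      obtain ⟨s, hs, hx⟩ := x.2
      exact Set.mem_iUnion.2 ⟨⟨s, hs⟩, hx⟩
    · rw [continuousOn_iff_continuous_domRestrict]
      exact (K.continuous_simplexInclusion s).comp
        (Continuous.subtype_mk (continuous_subtype_val.comp continuous_subtype_val) fun x => x.2)
  refine ⟨⟨le_antisymm (continuous_iff_le_induced.1 K.continuous_val) ?_⟩,
    Subtype.val_injective⟩
  exact continuous_id_iff_le.1 hid

theorem IsLocallyFinite.continuous_iff {K : AbstractSimplicialComplex V} (hK : K.IsLocallyFinite)
    {X : Type*} [TopologicalSpace X] {f : X → K.Realization} :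
    Continuous f ↔ ∀ v, Continuous fun x => (f x).1 v := by
  rw [hK.isEmbedding_val.continuous_iff, continuous_pi_iff]
  rfl

theorem continuous_coord (K : AbstractSimplicialComplex V) (v : V) :
    Continuous fun x : K.Realization => x.1 v :=
  (continuous_apply v).comp K.continuous_val

/-- The points of the realisation supported on a set `W` of vertices, i.e. the realisation of the
full subcomplex on `W`. -/
def supportedOn (K : AbstractSimplicialComplex V) (W : Set V) : Set K.Realization :=
  {x | ∀ v, x.1 v ≠ 0 → v ∈ W}

theorem IsLocallyFinite.exists_finite_subset_supportedOn {K : AbstractSimplicialComplex V}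
    (hK : K.IsLocallyFinite) {C : Set K.Realization} (hC : IsCompact C) :
    ∃ S : Set V, S.Finite ∧ C ⊆ K.supportedOn S := by
  obtain ⟨t, ht⟩ := hC.elim_finite_subcover (fun v => {x : K.Realization | 0 < x.1 v})
    (fun v => isOpen_lt continuous_const (K.continuous_coord v)) fun x _ => by
      obtain ⟨s, _, hx⟩ := x.2
      exact Set.mem_iUnion.2 (exists_pos_of_mem_closedSimplex hx)
  refine ⟨⋃ v ∈ t, ⋃ s ∈ {s | s ∈ K.faces ∧ v ∈ s}, (s : Set V),
    t.finite_toSet.biUnion fun v _ => (hK v).biUnion fun s _ => s.finite_toSet,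
    fun x hx u hu => ?_⟩
  obtain ⟨v, hv, hxv⟩ := Set.mem_iUnion₂.1 (ht hx)
  obtain ⟨s, hs, hxs⟩ := x.2
  exact Set.mem_iUnion₂.2 ⟨v, hv, Set.mem_iUnion₂.2
    ⟨s, ⟨hs, mem_of_mem_closedSimplex hxs (ne_of_gt hxv)⟩, mem_of_mem_closedSimplex hxs hu⟩⟩

/-- The affine extension of a vertex map with finite fibres, in barycentric coordinates. -/
noncomputable def pushforward (r : V → V) (hr : ∀ v, (r ⁻¹' {v}).Finite) (x : V → ℝ) (v : V) : ℝ :=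
  ∑ u ∈ (hr v).toFinset, x u

theorem pushforward_mem_closedSimplex [DecidableEq V] {r : V → V} (hr : ∀ v, (r ⁻¹' {v}).Finite)
    {s : Finset V} {x : V → ℝ} (hx : x ∈ closedSimplex s) :
    pushforward r hr x ∈ closedSimplex (s.image r) := by
  have h : ∀ v, pushforward r hr x v = ∑ u ∈ s with r u = v, x u := fun v => by
    refine (Finset.sum_subset (fun u hu => ?_) fun u hu hu' => hx.2.1 u fun h => hu' ?_).symm
    · simpa using (Finset.mem_filter.1 hu).2
    · exact Finset.mem_filter.2 ⟨h, by simpa using hu⟩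
  refine ⟨fun v => Finset.sum_nonneg fun u _ => hx.1 u, fun v hv => ?_, ?_⟩
  · rw [h, Finset.sum_eq_zero]
    intro u hu
    obtain ⟨hu, huv⟩ := Finset.mem_filter.1 hu
    exact absurd (Finset.mem_image.2 ⟨u, hu, huv⟩) hv
  · simp only [h]
    rw [Finset.sum_fiberwise_of_maps_to fun u hu => Finset.mem_image_of_mem r hu, hx.2.2]

/-- If every face of the full subcomplex on `W` spans a common face with its image under the
vertex map `r`, then the straight-line homotopy joins the identity of that subcomplex to the affine
extension of `r`. Hence the subcomplex is contractible as soon as `r` maps it into a contractible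
subcomplex. -/
theorem IsLocallyFinite.contractibleSpace_supportedOn
    {K : AbstractSimplicialComplex V} (hK : K.IsLocallyFinite)
    {W W' : Set V} (hW : W' ⊆ W) (r : V → V) (hrW : Set.MapsTo r W W')
    (hface : ∀ s ∈ K.faces, ↑s ⊆ W → ∃ t ∈ K.faces, ∀ c ∈ s, c ∈ t ∧ r c ∈ t)
    (hW' : ContractibleSpace (K.supportedOn W')) : ContractibleSpace (K.supportedOn W) := by
  classical
  -- Outside `W` the map is irrelevant; with the identity there, all fibres become finite.
  wlog hfix : ∀ c, c ∉ W → r c = c generalizing r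
  · refine this (fun c => if c ∈ W then r c else c) (fun c hc => ?_) (fun s hs hsW => ?_)
      fun c hc => if_neg hc
    · simpa [hc] using hrW hc
    · obtain ⟨t, ht, h⟩ := hface s hs hsW
      exact ⟨t, ht, fun c hc => by simpa [hsW hc] using h c hc⟩
  have hr : ∀ v, (r ⁻¹' {v}).Finite := fun v => by
    refine (((hK v).biUnion fun s _ => s.finite_toSet).union (Set.finite_singleton v)).subset ?_
    rintro c rfl
    by_cases hc : c ∈ W
    · obtain ⟨t, ht, h⟩ := hface {c} (K.singleton_mem c) (by simpa using hc)
      obtain ⟨h1, h2⟩ := h c (Finset.mem_singleton_self c)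
      exact Or.inl (Set.mem_iUnion₂.2 ⟨t, ⟨ht, h2⟩, h1⟩)
    · exact Or.inr (hfix c hc).symm
  have key : ∀ x : K.supportedOn W, ∃ s ∈ K.faces, ↑s ⊆ W ∧ x.1.1 ∈ closedSimplex s := fun x => by
    obtain ⟨s, hs, hx, h0⟩ := K.exists_face_support x.1
    exact ⟨s, hs, fun v hv => x.2 v (h0 v hv), hx⟩
  have hsupp : ∀ (x : K.supportedOn W) v, pushforward r hr x.1.1 v ≠ 0 → v ∈ W' := by
    intro x v hv
    obtain ⟨s, hs, hsW, hx⟩ := key x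
    obtain ⟨u, hu, rfl⟩ := Finset.mem_image.1
      (mem_of_mem_closedSimplex (pushforward_mem_closedSimplex hr hx) hv)
    exact hrW (hsW hu)
  have hline : ∀ (t : unitInterval) (x : K.supportedOn W), ∃ s ∈ K.faces,
      ((1 - t : ℝ) • x.1.1 + (t : ℝ) • pushforward r hr x.1.1) ∈ closedSimplex s := by
    intro t x
    obtain ⟨s, hs, hsW, hx⟩ := key x
    obtain ⟨u, hu, h⟩ := hface s hs hsW
    refine ⟨u, hu, convex_closedSimplex _
      (closedSimplex_mono (fun c hc => (h c hc).1) hx)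
      (closedSimplex_mono (Finset.image_subset_iff.2 fun c hc => (h c hc).2)
        (pushforward_mem_closedSimplex hr hx))
      (sub_nonneg.2 t.2.2) t.2.1 (by ring)⟩
  have hcont : ∀ v, Continuous fun x : K.supportedOn W => pushforward r hr x.1.1 v := fun v =>
    continuous_finsetSum _ fun u _ => (K.continuous_coord u).comp continuous_subtype_val
  let p : C(K.supportedOn W, K.supportedOn W') :=
    ⟨fun x => ⟨⟨pushforward r hr x.1.1, by simpa using hline 1 x⟩, hsupp x⟩,
      (hK.continuous_iff.2 hcont).subtype_mk _⟩
  let i : C(K.supportedOn W', K.supportedOn W) :=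
    ⟨fun x => ⟨x.1, fun v hv => hW (x.2 v hv)⟩, continuous_subtype_val.subtype_mk _⟩
  have hhom : (ContinuousMap.id (K.supportedOn W)).Homotopic (i.comp p) := by
    refine ⟨⟨⟨fun y => ⟨⟨(1 - y.1 : ℝ) • y.2.1.1 + (y.1 : ℝ) • pushforward r hr y.2.1.1,
      hline y.1 y.2⟩, fun v hv => ?_⟩, ?_⟩, fun x => ?_, fun x => ?_⟩⟩
    · by_contra h
      refine hv ?_
      have h1 : y.2.1.1 v = 0 := by
        by_contra h'
        exact h (y.2.2 v h')
      have h2 : pushforward r hr y.2.1.1 v = 0 := by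
        by_contra h'
        exact h (hW (hsupp y.2 v h'))
      simp [h1, h2]
    · refine Continuous.subtype_mk (hK.continuous_iff.2 fun v => ?_) _
      simp only [Pi.add_apply, Pi.smul_apply, smul_eq_mul]
      refine Continuous.add (Continuous.mul (by fun_prop) ?_) (Continuous.mul (by fun_prop) ?_)
      · exact (K.continuous_coord v).comp (continuous_subtype_val.comp continuous_snd)
      · exact (hcont v).comp continuous_snd
    · apply Subtype.ext
      apply Subtype.ext
      simp
    · apply Subtype.ext
      apply Subtype.ext
      simp [i, p]
  rw [contractible_iff_id_nullhomotopic]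
  obtain ⟨y, hy⟩ := ((id_nullhomotopic (K.supportedOn W')).comp_left p).comp_right i
  exact ⟨y, hhom.trans hy⟩

theorem contractibleSpace_supportedOn_singleton (K : AbstractSimplicialComplex V) (c : V) :
    ContractibleSpace (K.supportedOn {c}) := by
  classical
  have : Unique (K.supportedOn {c}) :=
    { default := ⟨⟨Pi.single c 1, {c}, K.singleton_mem c, by
        refine ⟨fun v => ?_, fun v hv => ?_, by simp⟩
        · by_cases h : v = c
          · subst h; simp
          · simp [h]
        · rw [Finset.mem_singleton] at hv
          simp [hv]⟩, fun v hv => by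
            by_contra h
            exact hv (Pi.single_eq_of_ne h _)⟩
      uniq := fun x => by
        obtain ⟨s, hs, hx, h0⟩ := K.exists_face_support x.1
        obtain rfl : s = {c} := Finset.eq_singleton_iff_nonempty_unique_mem.2
          ⟨(K.isRelLowerSet_faces hs).1, fun v hv => x.2 v (h0 v hv)⟩
        apply Subtype.ext
        apply Subtype.ext
        funext v
        by_cases h : v = c
        · subst h
          simpa using hx.2.2
        · simpa [h] using hx.2.1 v (by simpa using h) }
  infer_instance

/-- A locally finite complex is simply connected if it is a directed union of contractible full
subcomplexes: any two paths lie in one of them by compactness. -/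
theorem IsLocallyFinite.simplyConnectedSpace {K : AbstractSimplicialComplex V}
    (hK : K.IsLocallyFinite) {ι : Type*} (X : ι → Set V)
    (hX : ∀ S : Set V, S.Finite → ∃ i, S ⊆ X i)
    (hcon : ∀ i, ContractibleSpace (K.supportedOn (X i))) :
    SimplyConnectedSpace K.Realization := by
  have hC : ∀ C : Set K.Realization, IsCompact C → ∃ i, C ⊆ K.supportedOn (X i) := fun C h => by
    obtain ⟨S, hS, hCS⟩ := hK.exists_finite_subset_supportedOn h
    obtain ⟨i, hi⟩ := hX S hS
    exact ⟨i, fun x hx v hv => hi (hCS hx v hv)⟩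
  rw [simply_connected_iff_paths_homotopic']
  refine ⟨⟨?_, fun x y => ?_⟩, fun {x y} p q => ?_⟩
  · obtain ⟨i, -⟩ := hX ∅ Set.finite_empty
    exact ⟨(Classical.arbitrary (K.supportedOn (X i))).1⟩
  · obtain ⟨i, hi⟩ := hC {x, y} (Set.toFinite _).isCompact
    have h := PathConnectedSpace.joined (X := K.supportedOn (X i))
      ⟨x, hi (by simp)⟩ ⟨y, hi (by simp)⟩
    exact h.map continuous_subtype_val
  · obtain ⟨i, hi⟩ := hC (Set.range p ∪ Set.range q)
      ((isCompact_range p.continuous).union (isCompact_range q.continuous))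
    have hx : x ∈ K.supportedOn (X i) := hi (Or.inl ⟨0, p.source⟩)
    have hy : y ∈ K.supportedOn (X i) := hi (Or.inl ⟨1, p.target⟩)
    let lift : (γ : Path x y) → Set.range γ ⊆ K.supportedOn (X i) →
        Path (⟨x, hx⟩ : K.supportedOn (X i)) ⟨y, hy⟩ := fun γ hγ =>
      { toFun := fun t => ⟨γ t, hγ ⟨t, rfl⟩⟩
        continuous_toFun := γ.continuous.subtype_mk _
        source' := Subtype.ext γ.source
        target' := Subtype.ext γ.target }
    have h := SimplyConnectedSpace.paths_homotopic
      (lift p (Set.subset_union_left.trans hi)) (lift q (Set.subset_union_right.trans hi))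
    exact h.map ⟨Subtype.val, continuous_subtype_val⟩

end AbstractSimplicialComplex

/-! ### Rooted trees -/

namespace SimpleGraph

variable {α : Type u} {T : SimpleGraph α}

/-- A rooted tree structure on a graph: every vertex other than the root has a parent one level
below it, and every edge joins a vertex to its parent. -/
structure Rooting (T : SimpleGraph α) where
  root : α
  depth : α → ℕ
  parent : α → α
  depth_root : depth root = 0
  eq_root_of_depth_eq_zero : ∀ a, depth a = 0 → a = root
  adj_parent : ∀ a, a ≠ root → T.Adj a (parent a)
  depth_parent : ∀ a, a ≠ root → depth a = depth (parent a) + 1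
  eq_parent_or : ∀ a b, T.Adj a b → a ≠ root ∧ b = parent a ∨ b ≠ root ∧ a = parent b

namespace Rooting

theorem ne_root_of_depth (R : T.Rooting) {a : α} {n : ℕ} (h : R.depth a = n + 1) : a ≠ R.root := by
  rintro rfl
  simp [R.depth_root] at h

theorem exists_edge_eq (R : T.Rooting) (e : T.edgeSet) :
    ∃ a, a ≠ R.root ∧ (e : Sym2 α) = s(a, R.parent a) := by
  obtain ⟨e, he⟩ := e
  induction e using Sym2.ind with
  | _ a b =>
    rcases R.eq_parent_or a b he with ⟨h, rfl⟩ | ⟨h, rfl⟩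
    · exact ⟨a, h, rfl⟩
    · exact ⟨b, h, Sym2.eq_swap⟩

/-- The endpoint of an edge which is farther from the root. -/
noncomputable def top (R : T.Rooting) (e : T.edgeSet) : α := (R.exists_edge_eq e).choose

theorem top_ne_root (R : T.Rooting) (e : T.edgeSet) : R.top e ≠ R.root :=
  (R.exists_edge_eq e).choose_spec.1

theorem coe_edge (R : T.Rooting) (e : T.edgeSet) : (e : Sym2 α) = s(R.top e, R.parent (R.top e)) :=
  (R.exists_edge_eq e).choose_spec.2

theorem depth_top (R : T.Rooting) (e : T.edgeSet) :
    R.depth (R.top e) = R.depth (R.parent (R.top e)) + 1 := R.depth_parent _ (R.top_ne_root e)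

theorem mem_edge_iff (R : T.Rooting) (e : T.edgeSet) (a : α) :
    a ∈ (e : Sym2 α) ↔ a = R.top e ∨ a = R.parent (R.top e) := by
  conv_lhs => rw [R.coe_edge e]
  exact Sym2.mem_iff

theorem top_mem (R : T.Rooting) (e : T.edgeSet) : R.top e ∈ (e : Sym2 α) :=
  (R.mem_edge_iff e _).2 (Or.inl rfl)

theorem parent_top_mem (R : T.Rooting) (e : T.edgeSet) : R.parent (R.top e) ∈ (e : Sym2 α) :=
  (R.mem_edge_iff e _).2 (Or.inr rfl)

/-- The edge joining a vertex other than the root to its parent. -/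
def parentEdge (R : T.Rooting) (a : α) (h : a ≠ R.root) : T.edgeSet :=
  ⟨s(a, R.parent a), R.adj_parent a h⟩

theorem top_parentEdge (R : T.Rooting) (a : α) (h : a ≠ R.root) : R.top (R.parentEdge a h) = a := by
  have h1 := R.depth_top (R.parentEdge a h)
  have h2 := R.depth_parent a h
  have h3 : R.top (R.parentEdge a h) ∈ s(a, R.parent a) := R.top_mem _
  have h4 : a ∈ (R.parentEdge a h : Sym2 α) := Sym2.mem_mk_left _ _
  rw [Sym2.mem_iff] at h3
  rw [R.mem_edge_iff] at h4
  rcases h3 with h3 | h3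
  · exact h3
  · rcases h4 with h4 | h4
    · exact h4.symm
    · rw [h3, ← h3, ← h4] at h1
      rw [h3] at h1
      omega

theorem parentEdge_top (R : T.Rooting) (e : T.edgeSet) :
    R.parentEdge (R.top e) (R.top_ne_root e) = e := Subtype.ext (R.coe_edge e).symm

/-- A vertex of an edge of maximal depth is its top. -/
theorem eq_top (R : T.Rooting) {e : T.edgeSet} {a : α} (ha : a ∈ (e : Sym2 α))
    (h : R.depth (R.top e) ≤ R.depth a) : a = R.top e := by
  rcases (R.mem_edge_iff e a).1 ha with h' | h'
  · exact h'
  · have := R.depth_top e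
    rw [h'] at h
    omega

theorem connected (R : T.Rooting) : T.Connected := by
  have h : ∀ n a, R.depth a = n → T.Reachable a R.root := by
    intro n
    induction n with
    | zero =>
      intro a ha
      rw [R.eq_root_of_depth_eq_zero a ha]
    | succ n ih =>
      intro a ha
      have hr := R.ne_root_of_depth ha
      have := R.depth_parent a hr
      exact (R.adj_parent a hr).reachable.trans (ih _ (by omega))
  have : Nonempty α := ⟨R.root⟩
  exact ⟨fun a b => (h _ a rfl).trans (h _ b rfl).symm⟩

/-- On a cycle, both neighbours of a vertex of maximal depth would be its parent. -/
theorem isAcyclic (R : T.Rooting) : T.IsAcyclic := by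
  classical
  intro w c hc
  obtain ⟨a, ha, hmax⟩ := c.support.toFinset.exists_max_image R.depth
    ⟨w, List.mem_toFinset.2 c.start_mem_support⟩
  rw [List.mem_toFinset] at ha
  have hc' := hc.rotate ha
  have hpar : ∀ b ∈ (c.rotate a ha).support, T.Adj a b → b = R.parent a := by
    intro b hb hab
    have hb' : b ∈ c.support := by
      exact (SimpleGraph.Walk.mem_support_rotate_iff ..).1 hb
    rcases R.eq_parent_or a b hab with ⟨-, h⟩ | ⟨h, h'⟩
    · exact h
    · have h1 := hmax b (List.mem_toFinset.2 hb')
      have h2 := R.depth_parent b h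
      rw [← h'] at h2
      omega
  refine hc'.snd_ne_penultimate ?_
  exact (hpar _ (SimpleGraph.Walk.getVert_mem_support _ _)
    (SimpleGraph.Walk.adj_snd hc'.not_nil)).trans
    (hpar _ (SimpleGraph.Walk.getVert_mem_support _ _)
      (SimpleGraph.Walk.adj_penultimate hc'.not_nil).symm).symm

theorem isTree (R : T.Rooting) : T.IsTree := ⟨R.connected, R.isAcyclic⟩

end Rooting

theorem adj_of_mem_edge {e : T.edgeSet} {a b : α} (ha : a ∈ (e : Sym2 α)) (hb : b ∈ (e : Sym2 α))
    (hab : a ≠ b) : T.Adj a b := by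
  rw [← mem_edgeSet, ← (Sym2.mem_and_mem_iff hab).1 ⟨ha, hb⟩]
  exact e.2

end SimpleGraph

/-! ### Cells of the simplexification and local finiteness -/

namespace SimplexificationVertex

variable {α : Type u} {β : Type v} {T₁ : SimpleGraph α} {T₂ : SimpleGraph β}

/-- The vertex sets spanning the simplices of the simplexification; a nonempty finite set is a face
exactly when it lies in one of them. -/
inductive IsCell : Set (SimplexificationVertex T₁ T₂) → Prop
  | point (a : α) (b : β) : IsCell {vertex a b}
  | horizontal (e : T₁.edgeSet) (b : β) : IsCell (horizontalEdgeSimplex e b)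
  | triangle (e : T₁.edgeSet) (f : T₂.edgeSet) (b : β) (hb : b ∈ (f : Sym2 β)) :
      IsCell (triangleSimplex e f b)
  | vertical (a : α) (f : T₂.edgeSet) (b : β) (hb : b ∈ (f : Sym2 β)) :
      IsCell (verticalEdgeSimplex a f b)

theorem mem_faces_iff {s : Finset (SimplexificationVertex T₁ T₂)} :
    s ∈ (simplexification T₁ T₂).faces ↔
      s.Nonempty ∧ ∃ F : Set (SimplexificationVertex T₁ T₂), IsCell F ∧ ↑s ⊆ F := by
  refine and_congr_right fun _ => ⟨?_, ?_⟩
  · rintro (⟨a, b, h⟩ | ⟨e, b, h⟩ | ⟨e, f, b, hb, h⟩ | ⟨a, f, b, hb, h⟩)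
    · exact ⟨_, .point a b, h⟩
    · exact ⟨_, .horizontal e b, h⟩
    · exact ⟨_, .triangle e f b hb, h⟩
    · exact ⟨_, .vertical a f b hb, h⟩
  · rintro ⟨_, ⟨a, b⟩ | ⟨e, b⟩ | ⟨e, f, b, hb⟩ | ⟨a, f, b, hb⟩, h⟩
    · exact Or.inl ⟨a, b, h⟩
    · exact Or.inr (Or.inl ⟨e, b, h⟩)
    · exact Or.inr (Or.inr (Or.inl ⟨e, f, b, hb, h⟩))
    · exact Or.inr (Or.inr (Or.inr ⟨a, f, b, hb, h⟩))

/-- The vertices of the first factor underlying a vertex, edge or square of the product. -/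
def fstSet : SimplexificationVertex T₁ T₂ → Set α
  | vertex a _ => {a}
  | verticalEdge a _ => {a}
  | square e _ => {a | a ∈ (e : Sym2 α)}

/-- The vertices of the second factor underlying a vertex, edge or square of the product. -/
def sndSet : SimplexificationVertex T₁ T₂ → Set β
  | vertex _ b => {b}
  | verticalEdge _ f => {b | b ∈ (f : Sym2 β)}
  | square _ f => {b | b ∈ (f : Sym2 β)}

@[simp] theorem fstSet_vertex (a : α) (b : β) :
    (vertex a b : SimplexificationVertex T₁ T₂).fstSet = {a} := rfl
@[simp] theorem fstSet_verticalEdge (a : α) (f : T₂.edgeSet) :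
    (verticalEdge a f : SimplexificationVertex T₁ T₂).fstSet = {a} := rfl
@[simp] theorem fstSet_square (e : T₁.edgeSet) (f : T₂.edgeSet) :
    (square e f : SimplexificationVertex T₁ T₂).fstSet = {a | a ∈ (e : Sym2 α)} := rfl
@[simp] theorem sndSet_vertex (a : α) (b : β) :
    (vertex a b : SimplexificationVertex T₁ T₂).sndSet = {b} := rfl
@[simp] theorem sndSet_verticalEdge (a : α) (f : T₂.edgeSet) :
    (verticalEdge a f : SimplexificationVertex T₁ T₂).sndSet = {b | b ∈ (f : Sym2 β)} := rfl
@[simp] theorem sndSet_square (e : T₁.edgeSet) (f : T₂.edgeSet) :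
    (square e f : SimplexificationVertex T₁ T₂).sndSet = {b | b ∈ (f : Sym2 β)} := rfl

theorem _root_.Sym2.finite_toSet {γ : Type*} (e : Sym2 γ) : {a | a ∈ e}.Finite := by
  induction e using Sym2.ind with
  | _ a b => exact (Set.toFinite {a, b}).subset fun c hc => by simpa using hc

theorem finite_fstSet (c : SimplexificationVertex T₁ T₂) : c.fstSet.Finite := by
  cases c
  · exact Set.finite_singleton _
  · exact Set.finite_singleton _
  · exact Sym2.finite_toSet _

theorem finite_sndSet (c : SimplexificationVertex T₁ T₂) : c.sndSet.Finite := by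
  cases c
  · exact Set.finite_singleton _
  · exact Sym2.finite_toSet _
  · exact Sym2.finite_toSet _

theorem fstSet_nonempty (c : SimplexificationVertex T₁ T₂) : c.fstSet.Nonempty := by
  cases c
  · exact Set.singleton_nonempty _
  · exact Set.singleton_nonempty _
  · exact ⟨_, Sym2.out_fst_mem _⟩

theorem sndSet_nonempty (c : SimplexificationVertex T₁ T₂) : c.sndSet.Nonempty := by
  cases c
  · exact Set.singleton_nonempty _
  · exact ⟨_, Sym2.out_fst_mem _⟩
  · exact ⟨_, Sym2.out_fst_mem _⟩

theorem _root_.SimpleGraph.finite_edges_within {γ : Type*} (T : SimpleGraph γ) {A : Set γ}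
    (hA : A.Finite) :
    {e : T.edgeSet | ∀ a ∈ (e : Sym2 γ), a ∈ A}.Finite := by
  refine Set.Finite.of_finite_image (f := Subtype.val) ?_ Subtype.val_injective.injOn
  refine ((hA.prod hA).image fun p => s(p.1, p.2)).subset ?_
  rintro _ ⟨⟨e, he⟩, h, rfl⟩
  induction e using Sym2.ind with
  | _ a b => exact ⟨(a, b), ⟨h a (by simp), h b (by simp)⟩, rfl⟩

theorem finite_box {A : Set α} {B : Set β} (hA : A.Finite) (hB : B.Finite) :
    {c : SimplexificationVertex T₁ T₂ | c.fstSet ⊆ A ∧ c.sndSet ⊆ B}.Finite := by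
  have hA' := T₁.finite_edges_within hA
  have hB' := T₂.finite_edges_within hB
  refine (((hA.prod hB).image fun p => vertex p.1 p.2).union
    (((hA.prod hB').image fun p => verticalEdge p.1 p.2).union
      ((hA'.prod hB').image fun p => square p.1 p.2))).subset ?_
  rintro (⟨a, b⟩ | ⟨a, f⟩ | ⟨e, f⟩) ⟨h1, h2⟩
  · exact Or.inl ⟨(a, b), ⟨h1 rfl, h2 rfl⟩, rfl⟩
  · exact Or.inr (Or.inl ⟨(a, f), ⟨h1 rfl, h2⟩, rfl⟩)
  · exact Or.inr (Or.inr ⟨(e, f), ⟨h1, h2⟩, rfl⟩)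

theorem IsCell.snd_close {F : Set (SimplexificationVertex T₁ T₂)} (hF : IsCell F)
    {c c' : SimplexificationVertex T₁ T₂} (hc : c ∈ F) (hc' : c' ∈ F) {b b' : β}
    (hb : b ∈ c.sndSet) (hb' : b' ∈ c'.sndSet) : b = b' ∨ T₂.Adj b b' := by
  have key : (∃ b₀, ∀ c ∈ F, c.sndSet ⊆ {b₀}) ∨
      ∃ f : T₂.edgeSet, ∀ c ∈ F, c.sndSet ⊆ {b | b ∈ (f : Sym2 β)} := by
    rcases hF with ⟨a, b⟩ | ⟨e, b⟩ | ⟨e, f, b, hb⟩ | ⟨a, f, b, hb⟩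
    · refine Or.inl ⟨b, ?_⟩
      rintro _ rfl
      rfl
    · refine Or.inl ⟨b, ?_⟩
      rintro _ ⟨a, _, rfl⟩
      rfl
    · refine Or.inr ⟨f, ?_⟩
      rintro _ (rfl | ⟨a, _, rfl⟩)
      · exact subset_rfl
      · simpa using hb
    · refine Or.inr ⟨f, ?_⟩
      rintro _ ((rfl | rfl) | ⟨e, _, rfl⟩)
      · simpa using hb
      · exact subset_rfl
      · exact subset_rfl
  rcases key with ⟨b₀, h⟩ | ⟨f, h⟩
  · have h1 := h c hc hb
    have h2 := h c' hc' hb'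
    rw [Set.mem_singleton_iff] at h1 h2
    exact Or.inl (h1.trans h2.symm)
  · by_cases hbb : b = b'
    · exact Or.inl hbb
    · exact Or.inr (SimpleGraph.adj_of_mem_edge (h c hc hb) (h c' hc' hb') hbb)

/-- Two squares of a cell at a vertical edge may have endpoints at distance two, so a vertex under
`c'` is only near some vertex under `c`, not near all of them. -/
theorem IsCell.fst_close {F : Set (SimplexificationVertex T₁ T₂)} (hF : IsCell F)
    {c c' : SimplexificationVertex T₁ T₂} (hc : c ∈ F) (hc' : c' ∈ F) {a' : α}
    (ha' : a' ∈ c'.fstSet) : ∃ a ∈ c.fstSet, a = a' ∨ T₁.Adj a a' := by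
  have hedge : ∀ e : T₁.edgeSet, ∀ a ∈ (e : Sym2 α), ∀ a' ∈ (e : Sym2 α), a = a' ∨ T₁.Adj a a' :=
    fun e a ha a' ha' => by
      by_cases h : a = a'
      · exact Or.inl h
      · exact Or.inr (SimpleGraph.adj_of_mem_edge ha ha' h)
  have key : (∃ a₀, ∀ c ∈ F, a₀ ∈ c.fstSet ∧ ∀ a ∈ c.fstSet, a₀ = a ∨ T₁.Adj a₀ a) ∨
      ∃ e : T₁.edgeSet, ∀ c ∈ F, c.fstSet ⊆ {a | a ∈ (e : Sym2 α)} := by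
    rcases hF with ⟨a, b⟩ | ⟨e, b⟩ | ⟨e, f, b, hb⟩ | ⟨a, f, b, hb⟩
    · refine Or.inl ⟨a, ?_⟩
      rintro _ rfl
      simp
    · refine Or.inr ⟨e, ?_⟩
      rintro _ ⟨a, ha, rfl⟩
      simpa using ha
    · refine Or.inr ⟨e, ?_⟩
      rintro _ (rfl | ⟨a, ha, rfl⟩)
      · exact subset_rfl
      · simpa using ha
    · refine Or.inl ⟨a, ?_⟩
      rintro _ ((rfl | rfl) | ⟨e, ha, rfl⟩)
      · simp
      · simp
      · exact ⟨ha, fun a' ha' => hedge e a ha a' ha'⟩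
  rcases key with ⟨a₀, h⟩ | ⟨e, h⟩
  · exact ⟨a₀, (h c hc).1, (h c' hc').2 a' ha'⟩
  · obtain ⟨a, ha⟩ := c.fstSet_nonempty
    exact ⟨a, ha, hedge e a (h c hc ha) a' (h c' hc' ha')⟩

theorem isLocallyFinite (h₁ : ∀ a, (T₁.neighborSet a).Finite)
    (h₂ : ∀ b, (T₂.neighborSet b).Finite) : (simplexification T₁ T₂).IsLocallyFinite := by
  intro c
  have hA : (⋃ a ∈ c.fstSet, insert a (T₁.neighborSet a)).Finite :=
    c.finite_fstSet.biUnion fun a _ => (h₁ a).insert a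
  have hB : (⋃ b ∈ c.sndSet, insert b (T₂.neighborSet b)).Finite :=
    c.finite_sndSet.biUnion fun b _ => (h₂ b).insert b
  have hbox := finite_box (T₁ := T₁) (T₂ := T₂) hA hB
  refine hbox.toFinset.powerset.finite_toSet.subset ?_
  rintro s ⟨hs, hc⟩
  obtain ⟨-, F, hF, hsF⟩ := mem_faces_iff.1 hs
  rw [Finset.mem_coe, Finset.mem_powerset]
  intro c' hc'
  rw [Set.Finite.mem_toFinset]
  refine ⟨fun a' ha' => ?_, fun b' hb' => ?_⟩
  · obtain ⟨a, ha, h⟩ := hF.fst_close (hsF hc) (hsF hc') ha'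
    exact Set.mem_iUnion₂.2 ⟨a, ha, h.imp Eq.symm id⟩
  · obtain ⟨b, hb⟩ := c.sndSet_nonempty
    exact Set.mem_iUnion₂.2 ⟨b, hb, (hF.snd_close (hsF hc) (hsF hc') hb hb').imp Eq.symm id⟩

end SimplexificationVertex

/-! ### Contractions along rooted trees -/

namespace SimplexificationVertex

variable {α : Type u} {β : Type v} {T₁ : SimpleGraph α} {T₂ : SimpleGraph β}

open AbstractSimplicialComplex

/-- `IsLocallyFinite.contractibleSpace_supportedOn` in terms of cells. -/
theorem contractibleSpace_of_cells (hK : (simplexification T₁ T₂).IsLocallyFinite)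
    {W W' : Set (SimplexificationVertex T₁ T₂)} (hW : W' ⊆ W)
    (r : SimplexificationVertex T₁ T₂ → SimplexificationVertex T₁ T₂) (hrW : Set.MapsTo r W W')
    (hcell : ∀ F, IsCell F → ∃ F', IsCell F' ∧ ∀ c ∈ F, c ∈ W → c ∈ F' ∧ r c ∈ F')
    (hW' : ContractibleSpace ((simplexification T₁ T₂).supportedOn W')) :
    ContractibleSpace ((simplexification T₁ T₂).supportedOn W) := by
  classical
  refine hK.contractibleSpace_supportedOn hW r hrW (fun s hs hsW => ?_) hW'
  obtain ⟨hne, F, hF, hsF⟩ := mem_faces_iff.1 hs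
  obtain ⟨F', hF', h⟩ := hcell F hF
  refine ⟨s ∪ s.image r, mem_faces_iff.2 ⟨hne.mono Finset.subset_union_left, F', hF', ?_⟩,
    fun c hc => ⟨Finset.mem_union_left _ hc,
      Finset.mem_union_right _ (Finset.mem_image_of_mem r hc)⟩⟩
  intro c hc
  rcases Finset.mem_union.1 (Finset.mem_coe.1 hc) with hc | hc
  · exact (h c (hsF hc) (hsW hc)).1
  · obtain ⟨d, hd, rfl⟩ := Finset.mem_image.1 hc
    exact (h d (hsF hd) (hsW hd)).2

/-- The part of the simplexification above the balls of radius `N` and `M` about the roots. -/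
def depthBox (R₁ : T₁.Rooting) (R₂ : T₂.Rooting) (N M : ℕ) : Set (SimplexificationVertex T₁ T₂) :=
  {c | (∀ a ∈ c.fstSet, R₁.depth a ≤ N) ∧ ∀ b ∈ c.sndSet, R₂.depth b ≤ M}

section Mem

variable {R₁ : T₁.Rooting} {R₂ : T₂.Rooting} {N M : ℕ}

theorem vertex_mem_depthBox {a : α} {b : β} :
    vertex a b ∈ depthBox R₁ R₂ N M ↔ R₁.depth a ≤ N ∧ R₂.depth b ≤ M := by
  simp [depthBox]

theorem forall_depth_le_iff {γ : Type*} {T : SimpleGraph γ} (R : T.Rooting) (e : T.edgeSet)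
    (n : ℕ) :
    (∀ a ∈ (e : Sym2 γ), R.depth a ≤ n) ↔ R.depth (R.top e) ≤ n := by
  refine ⟨fun h => h _ (R.top_mem e), fun h a ha => ?_⟩
  have := R.depth_top e
  rcases (R.mem_edge_iff e a).1 ha with rfl | rfl <;> omega

theorem verticalEdge_mem_depthBox {a : α} {f : T₂.edgeSet} :
    verticalEdge a f ∈ depthBox R₁ R₂ N M ↔ R₁.depth a ≤ N ∧ R₂.depth (R₂.top f) ≤ M := by
  simp [depthBox, forall_depth_le_iff]

theorem square_mem_depthBox {e : T₁.edgeSet} {f : T₂.edgeSet} :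
    square e f ∈ depthBox R₁ R₂ N M ↔
      R₁.depth (R₁.top e) ≤ N ∧ R₂.depth (R₂.top f) ≤ M := by
  simp [depthBox, forall_depth_le_iff]

end Mem

theorem vertex_mem_horizontal {e : T₁.edgeSet} {a : α} {b : β} (ha : a ∈ (e : Sym2 α)) :
    (vertex a b : SimplexificationVertex T₁ T₂) ∈ horizontalEdgeSimplex e b := ⟨a, ha, rfl⟩

theorem vertex_mem_triangle {e : T₁.edgeSet} {f : T₂.edgeSet} {a : α} {b : β}
    (ha : a ∈ (e : Sym2 α)) : vertex a b ∈ triangleSimplex e f b := Or.inr ⟨a, ha, rfl⟩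

theorem square_mem_triangle {e : T₁.edgeSet} {f : T₂.edgeSet} {b : β} :
    square e f ∈ triangleSimplex e f b := Or.inl rfl

theorem vertex_mem_vertical {a : α} {f : T₂.edgeSet} {b : β} :
    (vertex a b : SimplexificationVertex T₁ T₂) ∈ verticalEdgeSimplex a f b := Or.inl (Or.inl rfl)

theorem verticalEdge_mem_vertical {a : α} {f : T₂.edgeSet} {b : β} :
    (verticalEdge a f : SimplexificationVertex T₁ T₂) ∈ verticalEdgeSimplex a f b :=
  Or.inl (Or.inr rfl)

theorem square_mem_vertical {a : α} {e : T₁.edgeSet} {f : T₂.edgeSet} {b : β}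
    (ha : a ∈ (e : Sym2 α)) : square e f ∈ verticalEdgeSimplex a f b := Or.inr ⟨e, ha, rfl⟩

/-- Contraction of the leaves of the first tree at depth `N + 1`. Successively the midpoints
`(a, f)` of the vertical edges over a leaf `a` move to the centres of the adjacent squares, the
vertices `(a, b)` move along the horizontal edges, and the centres of the squares move to the
midpoints of the opposite vertical edges. -/
theorem contractibleSpace_depthBox_succ_left (hK : (simplexification T₁ T₂).IsLocallyFinite)
    (R₁ : T₁.Rooting) (R₂ : T₂.Rooting) (N M : ℕ)
    (h : ContractibleSpace ((simplexification T₁ T₂).supportedOn (depthBox R₁ R₂ N M))) :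
    ContractibleSpace ((simplexification T₁ T₂).supportedOn (depthBox R₁ R₂ (N + 1) M)) := by
  classical
  let W₁ : Set (SimplexificationVertex T₁ T₂) := depthBox R₁ R₂ (N + 1) M \
    {c | ∃ a f, c = verticalEdge a f ∧ R₁.depth a = N + 1}
  let W₂ : Set (SimplexificationVertex T₁ T₂) := W₁ \
    {c | ∃ a b, c = vertex a b ∧ R₁.depth a = N + 1}
  have hv₁ : ∀ {a f}, verticalEdge a f ∈ W₁ → R₁.depth a ≤ N ∧ R₂.depth (R₂.top f) ≤ M :=
    fun {a f} hc => by
      have h1 := verticalEdge_mem_depthBox.1 hc.1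
      have h2 : R₁.depth a ≠ N + 1 := fun h => hc.2 ⟨a, f, rfl, h⟩
      exact ⟨by omega, h1.2⟩
  have hv₂ : ∀ {a b}, vertex a b ∈ W₂ → R₁.depth a ≤ N ∧ R₂.depth b ≤ M :=
    fun {a b} hc => by
      have h1 := vertex_mem_depthBox.1 hc.1.1
      have h2 : R₁.depth a ≠ N + 1 := fun h => hc.2 ⟨a, b, rfl, h⟩
      exact ⟨by omega, h1.2⟩
  have hsq : ∀ {e : T₁.edgeSet} {f : T₂.edgeSet} {a : α}, square e f ∈ depthBox R₁ R₂ (N + 1) M →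
      a ∈ (e : Sym2 α) → R₁.depth a = N + 1 → R₁.top e = a := fun {e f a} hc ha hd => by
    have h1 := (square_mem_depthBox.1 hc).1
    exact (R₁.eq_top ha (by omega)).symm
  -- the squares collapse onto the opposite vertical edges
  have h₂ : ContractibleSpace ((simplexification T₁ T₂).supportedOn W₂) := by
    let r : SimplexificationVertex T₁ T₂ → SimplexificationVertex T₁ T₂ := fun c =>
      match c with
      | square e f => if R₁.depth (R₁.top e) = N + 1 then verticalEdge (R₁.parent (R₁.top e)) f
          else square e f
      | c => c
    have hr : ∀ e f, r (square e f) = if R₁.depth (R₁.top e) = N + 1 then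
      verticalEdge (R₁.parent (R₁.top e)) f else square e f := fun e f => rfl
    refine contractibleSpace_of_cells hK ?_ r ?_ ?_ h
    · rintro (⟨a, b⟩ | ⟨a, f⟩ | ⟨e, f⟩) hc
      · have hc' := vertex_mem_depthBox.1 hc
        refine ⟨⟨vertex_mem_depthBox.2 ⟨by omega, hc'.2⟩, by simp⟩, ?_⟩
        rintro ⟨_, _, ⟨⟩, hd⟩
        omega
      · have hc' := verticalEdge_mem_depthBox.1 hc
        refine ⟨⟨verticalEdge_mem_depthBox.2 ⟨by omega, hc'.2⟩, ?_⟩, by simp⟩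
        rintro ⟨_, _, ⟨⟩, hd⟩
        omega
      · have hc' := square_mem_depthBox.1 hc
        exact ⟨⟨square_mem_depthBox.2 ⟨by omega, hc'.2⟩, by simp⟩, by simp⟩
    · rintro (⟨a, b⟩ | ⟨a, f⟩ | ⟨e, f⟩) hc
      · exact vertex_mem_depthBox.2 (hv₂ hc)
      · exact verticalEdge_mem_depthBox.2 (hv₁ hc.1)
      · have hc' := square_mem_depthBox.1 hc.1.1
        have := R₁.depth_top e
        rw [hr]
        split_ifs with hd
        · exact verticalEdge_mem_depthBox.2 ⟨by omega, hc'.2⟩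
        · exact square_mem_depthBox.2 ⟨by omega, hc'.2⟩
    · rintro _ (⟨a, b⟩ | ⟨e, b⟩ | ⟨e, f, b, hb⟩ | ⟨a, f, b, hb⟩)
      · refine ⟨_, .point a b, ?_⟩
        rintro _ rfl -
        exact ⟨rfl, rfl⟩
      · refine ⟨_, .horizontal e b, ?_⟩
        rintro _ ⟨a, ha, rfl⟩ -
        exact ⟨vertex_mem_horizontal ha, vertex_mem_horizontal ha⟩
      · by_cases hd : R₁.depth (R₁.top e) = N + 1
        · refine ⟨_, .vertical (R₁.parent (R₁.top e)) f b hb, ?_⟩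
          rintro _ (rfl | ⟨a, ha, rfl⟩) hc
          · rw [hr, if_pos hd]
            exact ⟨square_mem_vertical (R₁.parent_top_mem e), verticalEdge_mem_vertical⟩
          · have hc' := (hv₂ hc).1
            rcases (R₁.mem_edge_iff e a).1 ha with rfl | rfl
            · omega
            · exact ⟨vertex_mem_vertical, vertex_mem_vertical⟩
        · refine ⟨_, .triangle e f b hb, ?_⟩
          rintro _ (rfl | ⟨a, ha, rfl⟩) -
          · rw [hr, if_neg hd]
            exact ⟨square_mem_triangle, square_mem_triangle⟩
          · exact ⟨vertex_mem_triangle ha, vertex_mem_triangle ha⟩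
      · by_cases hd : R₁.depth a = N + 1
        · refine ⟨_, .vertical (R₁.parent a) f b hb, ?_⟩
          rintro _ ((rfl | rfl) | ⟨e, ha, rfl⟩) hc
          · have := (hv₂ hc).1
            omega
          · have := (hv₁ hc.1).1
            omega
          · obtain rfl := hsq hc.1.1 ha hd
            rw [hr, if_pos hd]
            exact ⟨square_mem_vertical (R₁.parent_top_mem e), verticalEdge_mem_vertical⟩
        · refine ⟨_, .vertical a f b hb, ?_⟩
          rintro _ ((rfl | rfl) | ⟨e, ha, rfl⟩) hc
          · exact ⟨vertex_mem_vertical, vertex_mem_vertical⟩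
          · exact ⟨verticalEdge_mem_vertical, verticalEdge_mem_vertical⟩
          · refine ⟨square_mem_vertical ha, ?_⟩
            rw [hr]
            split_ifs with hd'
            · rcases (R₁.mem_edge_iff e a).1 ha with rfl | rfl
              · exact absurd hd' hd
              · exact verticalEdge_mem_vertical
            · exact square_mem_vertical ha
  -- the vertices move along the horizontal edges
  have h₁ : ContractibleSpace ((simplexification T₁ T₂).supportedOn W₁) := by
    let r : SimplexificationVertex T₁ T₂ → SimplexificationVertex T₁ T₂ := fun c =>
      match c with
      | vertex a b => if R₁.depth a = N + 1 then vertex (R₁.parent a) b else vertex a b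
      | c => c
    have hr : ∀ a b, r (vertex a b) = if R₁.depth a = N + 1 then
      vertex (R₁.parent a) b else vertex a b := fun e f => rfl
    have hpoint : ∀ a b, ∃ F' : Set (SimplexificationVertex T₁ T₂), IsCell F' ∧
        vertex a b ∈ F' ∧ r (vertex a b) ∈ F' := fun a b => by
      by_cases hd : R₁.depth a = N + 1
      · refine ⟨_, .horizontal (R₁.parentEdge a (R₁.ne_root_of_depth hd)) b, ?_⟩
        rw [hr, if_pos hd]
        exact ⟨vertex_mem_horizontal (Sym2.mem_mk_left _ _),
          vertex_mem_horizontal (Sym2.mem_mk_right _ _)⟩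
      · refine ⟨_, .point a b, ?_⟩
        rw [hr, if_neg hd]
        exact ⟨rfl, rfl⟩
    have hedge : ∀ (e : T₁.edgeSet) b a, a ∈ (e : Sym2 α) → R₁.depth (R₁.top e) ≤ N + 1 →
        ∃ a' ∈ (e : Sym2 α), r (vertex a b) = vertex a' b := fun e b a ha hle => by
      rw [hr]
      split_ifs with hd
      · obtain rfl := R₁.eq_top ha (by omega)
        exact ⟨_, R₁.parent_top_mem e, rfl⟩
      · exact ⟨a, ha, rfl⟩
    have hlow : ∀ (e : T₁.edgeSet) b a, a ∈ (e : Sym2 α) → ¬ R₁.depth (R₁.top e) ≤ N + 1 →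
        vertex a b ∈ W₁ → a = R₁.parent (R₁.top e) := fun e b a ha hle hc => by
      have := (vertex_mem_depthBox.1 hc.1).1
      rcases (R₁.mem_edge_iff e a).1 ha with rfl | rfl
      · exact absurd this hle
      · rfl
    refine contractibleSpace_of_cells hK Set.sdiff_subset r ?_ ?_ h₂
    · rintro (⟨a, b⟩ | ⟨a, f⟩ | ⟨e, f⟩) hc
      · have hc' := vertex_mem_depthBox.1 hc.1
        rw [hr]
        split_ifs with hd
        · have := R₁.depth_parent a (R₁.ne_root_of_depth hd)
          refine ⟨⟨vertex_mem_depthBox.2 ⟨by omega, hc'.2⟩, by simp⟩, ?_⟩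
          rintro ⟨_, _, ⟨⟩, hd⟩
          omega
        · refine ⟨hc, ?_⟩
          rintro ⟨_, _, ⟨⟩, hd'⟩
          exact hd hd'
      · exact ⟨hc, by simp [r]⟩
      · exact ⟨hc, by simp [r]⟩
    · rintro _ (⟨a, b⟩ | ⟨e, b⟩ | ⟨e, f, b, hb⟩ | ⟨a, f, b, hb⟩)
      · obtain ⟨F', hF', h⟩ := hpoint a b
        refine ⟨F', hF', ?_⟩
        rintro _ rfl -
        exact h
      · by_cases hle : R₁.depth (R₁.top e) ≤ N + 1
        · refine ⟨_, .horizontal e b, ?_⟩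
          rintro _ ⟨a, ha, rfl⟩ -
          obtain ⟨a', ha', h⟩ := hedge e b a ha hle
          exact ⟨vertex_mem_horizontal ha, h ▸ vertex_mem_horizontal ha'⟩
        · obtain ⟨F', hF', h⟩ := hpoint (R₁.parent (R₁.top e)) b
          refine ⟨F', hF', ?_⟩
          rintro _ ⟨a, ha, rfl⟩ hc
          obtain rfl := hlow e b a ha hle hc
          exact h
      · by_cases hle : R₁.depth (R₁.top e) ≤ N + 1
        · refine ⟨_, .triangle e f b hb, ?_⟩
          rintro _ (rfl | ⟨a, ha, rfl⟩) -
          · exact ⟨square_mem_triangle, square_mem_triangle⟩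
          · obtain ⟨a', ha', h⟩ := hedge e b a ha hle
            exact ⟨vertex_mem_triangle ha, h ▸ vertex_mem_triangle ha'⟩
        · obtain ⟨F', hF', h⟩ := hpoint (R₁.parent (R₁.top e)) b
          refine ⟨F', hF', ?_⟩
          rintro _ (rfl | ⟨a, ha, rfl⟩) hc
          · exact absurd (square_mem_depthBox.1 hc.1).1 hle
          · obtain rfl := hlow e b a ha hle hc
            exact h
      · by_cases hd : R₁.depth a = N + 1
        · have ha := R₁.ne_root_of_depth hd
          have hmem : a ∈ (R₁.parentEdge a ha : Sym2 α) := Sym2.mem_mk_left _ _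
          refine ⟨_, .triangle (R₁.parentEdge a ha) f b hb, ?_⟩
          rintro _ ((rfl | rfl) | ⟨e, ha, rfl⟩) hc
          · rw [hr, if_pos hd]
            exact ⟨vertex_mem_triangle hmem, vertex_mem_triangle (Sym2.mem_mk_right _ _)⟩
          · have := (hv₁ hc).1
            omega
          · obtain rfl := hsq hc.1 ha hd
            rw [R₁.parentEdge_top e]
            exact ⟨square_mem_triangle, square_mem_triangle⟩
        · refine ⟨_, .vertical a f b hb, ?_⟩
          rintro _ ((rfl | rfl) | ⟨e, ha, rfl⟩) hc
          · rw [hr, if_neg hd]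
            exact ⟨vertex_mem_vertical, vertex_mem_vertical⟩
          · exact ⟨verticalEdge_mem_vertical, verticalEdge_mem_vertical⟩
          · exact ⟨square_mem_vertical ha, square_mem_vertical ha⟩
  -- the midpoints of the vertical edges move to the centres of the squares
  let r : SimplexificationVertex T₁ T₂ → SimplexificationVertex T₁ T₂ := fun c =>
    match c with
    | verticalEdge a f => if hd : R₁.depth a = N + 1 then
        square (R₁.parentEdge a (R₁.ne_root_of_depth hd)) f else verticalEdge a f
    | c => c
  have hr : ∀ a f, r (verticalEdge a f) = if hd : R₁.depth a = N + 1 then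
    square (R₁.parentEdge a (R₁.ne_root_of_depth hd)) f else verticalEdge a f := fun e f => rfl
  refine contractibleSpace_of_cells hK Set.sdiff_subset r ?_ ?_ h₁
  · rintro (⟨a, b⟩ | ⟨a, f⟩ | ⟨e, f⟩) hc
    · exact ⟨hc, by simp [r]⟩
    · rw [hr]
      have hc' := verticalEdge_mem_depthBox.1 hc
      split_ifs with hd
      · refine ⟨square_mem_depthBox.2 ⟨?_, hc'.2⟩, by simp⟩
        rw [R₁.top_parentEdge]
        exact hd.le
      · refine ⟨hc, ?_⟩
        rintro ⟨_, _, ⟨⟩, hd'⟩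
        exact hd hd'
    · exact ⟨hc, by simp [r]⟩
  · intro F hF
    refine ⟨F, hF, fun c hc _ => ⟨hc, ?_⟩⟩
    rcases hF with ⟨a, b⟩ | ⟨e, b⟩ | ⟨e, f, b, hb⟩ | ⟨a, f, b, hb⟩
    · rcases hc with rfl
      rfl
    · rcases hc with ⟨a, ha, rfl⟩
      exact vertex_mem_horizontal ha
    · rcases hc with (rfl | ⟨a, ha, rfl⟩)
      · exact square_mem_triangle
      · exact vertex_mem_triangle ha
    · rcases hc with ((rfl | rfl) | ⟨e, ha, rfl⟩)
      · exact vertex_mem_vertical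
      · rw [hr]
        split_ifs with hd
        · exact square_mem_vertical (Sym2.mem_mk_left _ _)
        · exact verticalEdge_mem_vertical
      · exact square_mem_vertical ha

/-- Once the first tree is reduced to its root, the leaves of the second tree at depth `M + 1` are
contracted: the vertices move to the midpoints of the vertical edges below them, and these midpoints
move to the lower endpoints. -/
theorem contractibleSpace_depthBox_succ_right (hK : (simplexification T₁ T₂).IsLocallyFinite)
    (R₁ : T₁.Rooting) (R₂ : T₂.Rooting) (M : ℕ)
    (h : ContractibleSpace ((simplexification T₁ T₂).supportedOn (depthBox R₁ R₂ 0 M))) :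
    ContractibleSpace ((simplexification T₁ T₂).supportedOn (depthBox R₁ R₂ 0 (M + 1))) := by
  classical
  let W₁ : Set (SimplexificationVertex T₁ T₂) := depthBox R₁ R₂ 0 (M + 1) \
    {c | ∃ a b, c = vertex a b ∧ R₂.depth b = M + 1}
  have hno : ∀ {e f}, ¬ square e f ∈ depthBox R₁ R₂ 0 (M + 1) := fun {e f} hc => by
    have h1 := (square_mem_depthBox.1 hc).1
    have h2 := R₁.depth_top e
    omega
  have hv₁ : ∀ {a b}, vertex a b ∈ W₁ → R₁.depth a ≤ 0 ∧ R₂.depth b ≤ M := fun {a b} hc => by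
    have h1 := vertex_mem_depthBox.1 hc.1
    have h2 : R₂.depth b ≠ M + 1 := fun h => hc.2 ⟨a, b, rfl, h⟩
    exact ⟨h1.1, by omega⟩
  have hroot : ∀ {a b}, vertex a b ∈ depthBox R₁ R₂ 0 (M + 1) → a = R₁.root := fun {a b} hc =>
    R₁.eq_root_of_depth_eq_zero a (Nat.le_zero.1 (vertex_mem_depthBox.1 hc).1)
  -- the midpoints of the vertical edges move down
  have h₁ : ContractibleSpace ((simplexification T₁ T₂).supportedOn W₁) := by
    let r : SimplexificationVertex T₁ T₂ → SimplexificationVertex T₁ T₂ := fun c =>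
      match c with
      | verticalEdge a f => if R₂.depth (R₂.top f) = M + 1 then vertex a (R₂.parent (R₂.top f))
          else verticalEdge a f
      | c => c
    have hr : ∀ a f, r (verticalEdge a f) = if R₂.depth (R₂.top f) = M + 1 then
      vertex a (R₂.parent (R₂.top f)) else verticalEdge a f := fun e f => rfl
    refine contractibleSpace_of_cells hK ?_ r ?_ ?_ h
    · rintro (⟨a, b⟩ | ⟨a, f⟩ | ⟨e, f⟩) hc
      · have hc' := vertex_mem_depthBox.1 hc
        refine ⟨vertex_mem_depthBox.2 ⟨hc'.1, by omega⟩, ?_⟩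
        rintro ⟨_, _, ⟨⟩, hd⟩
        omega
      · have hc' := verticalEdge_mem_depthBox.1 hc
        exact ⟨verticalEdge_mem_depthBox.2 ⟨hc'.1, by omega⟩, by simp⟩
      · have hc' := square_mem_depthBox.1 hc
        exact ⟨square_mem_depthBox.2 ⟨hc'.1, by omega⟩, by simp⟩
    · rintro (⟨a, b⟩ | ⟨a, f⟩ | ⟨e, f⟩) hc
      · exact vertex_mem_depthBox.2 (hv₁ hc)
      · have hc' := verticalEdge_mem_depthBox.1 hc.1
        have := R₂.depth_top f
        rw [hr]
        split_ifs with hd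
        · exact vertex_mem_depthBox.2 ⟨hc'.1, by omega⟩
        · exact verticalEdge_mem_depthBox.2 ⟨hc'.1, by omega⟩
      · exact absurd hc.1 hno
    · rintro _ (⟨a, b⟩ | ⟨e, b⟩ | ⟨e, f, b, hb⟩ | ⟨a, f, b, hb⟩)
      · refine ⟨_, .point a b, ?_⟩
        rintro _ rfl -
        exact ⟨rfl, rfl⟩
      · refine ⟨_, .horizontal e b, ?_⟩
        rintro _ ⟨a, ha, rfl⟩ -
        exact ⟨vertex_mem_horizontal ha, vertex_mem_horizontal ha⟩
      · refine ⟨_, .triangle e f b hb, ?_⟩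
        rintro _ (rfl | ⟨a, ha, rfl⟩) -
        · exact ⟨square_mem_triangle, square_mem_triangle⟩
        · exact ⟨vertex_mem_triangle ha, vertex_mem_triangle ha⟩
      · by_cases hd : R₂.depth (R₂.top f) = M + 1
        · refine ⟨_, .vertical a f _ (R₂.parent_top_mem f), ?_⟩
          rintro _ ((rfl | rfl) | ⟨e, ha, rfl⟩) hc
          · have := (hv₁ hc).2
            rcases (R₂.mem_edge_iff f b).1 hb with rfl | rfl
            · omega
            · exact ⟨vertex_mem_vertical, vertex_mem_vertical⟩
          · rw [hr, if_pos hd]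
            exact ⟨verticalEdge_mem_vertical, vertex_mem_vertical⟩
          · exact ⟨square_mem_vertical ha, square_mem_vertical ha⟩
        · refine ⟨_, .vertical a f b hb, ?_⟩
          rintro _ ((rfl | rfl) | ⟨e, ha, rfl⟩) hc
          · exact ⟨vertex_mem_vertical, vertex_mem_vertical⟩
          · rw [hr, if_neg hd]
            exact ⟨verticalEdge_mem_vertical, verticalEdge_mem_vertical⟩
          · exact ⟨square_mem_vertical ha, square_mem_vertical ha⟩
  -- the vertices move to the midpoints of the vertical edges
  let r : SimplexificationVertex T₁ T₂ → SimplexificationVertex T₁ T₂ := fun c =>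
    match c with
    | vertex a b => if hd : R₂.depth b = M + 1 then
        verticalEdge a (R₂.parentEdge b (R₂.ne_root_of_depth hd)) else vertex a b
    | c => c
  have hr : ∀ a b, r (vertex a b) = if hd : R₂.depth b = M + 1 then
    verticalEdge a (R₂.parentEdge b (R₂.ne_root_of_depth hd)) else vertex a b := fun e f => rfl
  have hpoint : ∀ a b, ∃ F' : Set (SimplexificationVertex T₁ T₂), IsCell F' ∧
      vertex a b ∈ F' ∧ r (vertex a b) ∈ F' := fun a b => by
    by_cases hd : R₂.depth b = M + 1
    · refine ⟨_, .vertical a (R₂.parentEdge b (R₂.ne_root_of_depth hd)) b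
        (Sym2.mem_mk_left _ _), ?_⟩
      rw [hr, dif_pos hd]
      exact ⟨vertex_mem_vertical, verticalEdge_mem_vertical⟩
    · refine ⟨_, .point a b, ?_⟩
      rw [hr, dif_neg hd]
      exact ⟨rfl, rfl⟩
  refine contractibleSpace_of_cells hK Set.sdiff_subset r ?_ ?_ h₁
  · rintro (⟨a, b⟩ | ⟨a, f⟩ | ⟨e, f⟩) hc
    · rw [hr]
      have hc' := vertex_mem_depthBox.1 hc
      split_ifs with hd
      · refine ⟨verticalEdge_mem_depthBox.2 ⟨hc'.1, ?_⟩, by simp⟩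
        rw [R₂.top_parentEdge]
        exact hd.le
      · refine ⟨hc, ?_⟩
        rintro ⟨_, _, ⟨⟩, hd'⟩
        exact hd hd'
    · exact ⟨hc, by simp [r]⟩
    · exact absurd hc hno
  · rintro _ (⟨a, b⟩ | ⟨e, b⟩ | ⟨e, f, b, hb⟩ | ⟨a, f, b, hb⟩)
    · obtain ⟨F', hF', h⟩ := hpoint a b
      refine ⟨F', hF', ?_⟩
      rintro _ rfl -
      exact h
    · obtain ⟨F', hF', h⟩ := hpoint R₁.root b
      refine ⟨F', hF', ?_⟩
      rintro _ ⟨a, ha, rfl⟩ hc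
      rw [hroot hc]
      exact h
    · obtain ⟨F', hF', h⟩ := hpoint R₁.root b
      refine ⟨F', hF', ?_⟩
      rintro _ (rfl | ⟨a, ha, rfl⟩) hc
      · exact absurd hc hno
      · rw [hroot hc]
        exact h
    · by_cases hle : R₂.depth (R₂.top f) ≤ M + 1
      · refine ⟨_, .vertical a f b hb, ?_⟩
        rintro _ ((rfl | rfl) | ⟨e, ha, rfl⟩) hc
        · refine ⟨vertex_mem_vertical, ?_⟩
          rw [hr]
          split_ifs with hd
          · obtain rfl := R₂.eq_top hb (by omega)
            rw [R₂.parentEdge_top]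
            exact verticalEdge_mem_vertical
          · exact vertex_mem_vertical
        · exact ⟨verticalEdge_mem_vertical, verticalEdge_mem_vertical⟩
        · exact absurd hc hno
      · obtain ⟨F', hF', h⟩ := hpoint a b
        refine ⟨F', hF', ?_⟩
        rintro _ ((rfl | rfl) | ⟨e, ha, rfl⟩) hc
        · exact h
        · exact absurd (verticalEdge_mem_depthBox.1 hc).2 hle
        · exact absurd hc hno

theorem contractibleSpace_depthBox (hK : (simplexification T₁ T₂).IsLocallyFinite)
    (R₁ : T₁.Rooting) (R₂ : T₂.Rooting) (N M : ℕ) :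
    ContractibleSpace ((simplexification T₁ T₂).supportedOn (depthBox R₁ R₂ N M)) := by
  induction N with
  | succ N ih => exact contractibleSpace_depthBox_succ_left hK R₁ R₂ N M ih
  | zero =>
    induction M with
    | succ M ih => exact contractibleSpace_depthBox_succ_right hK R₁ R₂ M ih
    | zero =>
      have h : depthBox R₁ R₂ 0 0 = {vertex R₁.root R₂.root} := by
        refine Set.Subset.antisymm ?_ ?_
        · rintro (⟨a, b⟩ | ⟨a, f⟩ | ⟨e, f⟩) hc
          · obtain ⟨h1, h2⟩ := vertex_mem_depthBox.1 hc
            rw [R₁.eq_root_of_depth_eq_zero a (Nat.le_zero.1 h1),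
              R₂.eq_root_of_depth_eq_zero b (Nat.le_zero.1 h2)]
            rfl
          · have := (verticalEdge_mem_depthBox.1 hc).2
            have := R₂.depth_top f
            omega
          · have := (square_mem_depthBox.1 hc).2
            have := R₂.depth_top f
            omega
        · rintro _ rfl
          exact vertex_mem_depthBox.2 ⟨R₁.depth_root.le, R₂.depth_root.le⟩
      rw [h]
      exact contractibleSpace_supportedOn_singleton _ _

theorem simplyConnectedSpace (hK : (simplexification T₁ T₂).IsLocallyFinite)
    (R₁ : T₁.Rooting) (R₂ : T₂.Rooting) :
    SimplyConnectedSpace (simplexification T₁ T₂).Realization := by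
  refine hK.simplyConnectedSpace (fun n : ℕ => depthBox R₁ R₂ n n) (fun S hS => ?_)
    fun n => contractibleSpace_depthBox hK R₁ R₂ n n
  obtain ⟨N, hN⟩ := ((hS.biUnion fun c _ => c.finite_fstSet).image R₁.depth).bddAbove
  obtain ⟨M, hM⟩ := ((hS.biUnion fun c _ => c.finite_sndSet).image R₂.depth).bddAbove
  refine ⟨max N M, fun c hc => ⟨fun a ha => ?_, fun b hb => ?_⟩⟩
  · exact (hN ⟨a, Set.mem_iUnion₂.2 ⟨c, hc, ha⟩, rfl⟩).trans (le_max_left _ _)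
  · exact (hM ⟨b, Set.mem_iUnion₂.2 ⟨c, hc, hb⟩, rfl⟩).trans (le_max_right _ _)

end SimplexificationVertex

/-! ### Local 6-largeness -/

/-- A graph has no induced cycle of length `4` or `5` if on induced paths `x, y, z` a predicate `P`
behaves as on a cycle coloured with period three, every third vertex having the property: then the
length of an induced cycle would be divisible by `3`. -/
theorem SimpleGraph.not_cycleGraph_embedding_of_period_three {V : Type*} {G : SimpleGraph V}
    (P : V → Prop)
    (h : ∀ x y z, G.Adj x y → G.Adj y z → x ≠ z → ¬ G.Adj x z →
      (P y → ¬ P x) ∧ (¬ P y → (P x ↔ ¬ P z))) :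
    ¬ Nonempty (cycleGraph 4 ↪g G) ∧ ¬ Nonempty (cycleGraph 5 ↪g G) := by
  constructor
  · rintro ⟨φ⟩
    have key : ∀ i j k : Fin 4, (cycleGraph 4).Adj i j → (cycleGraph 4).Adj j k → i ≠ k →
        ¬ (cycleGraph 4).Adj i k → (P (φ j) → ¬ P (φ i)) ∧ (¬ P (φ j) → (P (φ i) ↔ ¬ P (φ k))) :=
      fun i j k h1 h2 h3 h4 => h _ _ _ (φ.map_adj_iff.2 h1) (φ.map_adj_iff.2 h2)
        (fun h => h3 (φ.injective h)) fun h => h4 (φ.map_adj_iff.1 h)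
    have h0 := key 0 1 2 (by decide) (by decide) (by decide) (by decide)
    have h1 := key 1 2 3 (by decide) (by decide) (by decide) (by decide)
    have h2 := key 2 3 0 (by decide) (by decide) (by decide) (by decide)
    have h3 := key 3 0 1 (by decide) (by decide) (by decide) (by decide)
    clear h key
    by_cases p0 : P (φ 0) <;> by_cases p1 : P (φ 1) <;> simp_all
  · rintro ⟨φ⟩
    have key : ∀ i j k : Fin 5, (cycleGraph 5).Adj i j → (cycleGraph 5).Adj j k → i ≠ k →
        ¬ (cycleGraph 5).Adj i k → (P (φ j) → ¬ P (φ i)) ∧ (¬ P (φ j) → (P (φ i) ↔ ¬ P (φ k))) :=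
      fun i j k h1 h2 h3 h4 => h _ _ _ (φ.map_adj_iff.2 h1) (φ.map_adj_iff.2 h2)
        (fun h => h3 (φ.injective h)) fun h => h4 (φ.map_adj_iff.1 h)
    have h0 := key 0 1 2 (by decide) (by decide) (by decide) (by decide)
    have h1 := key 1 2 3 (by decide) (by decide) (by decide) (by decide)
    have h2 := key 2 3 4 (by decide) (by decide) (by decide) (by decide)
    have h3 := key 3 4 0 (by decide) (by decide) (by decide) (by decide)
    have h4 := key 4 0 1 (by decide) (by decide) (by decide) (by decide)
    clear h key
    by_cases p0 : P (φ 0) <;> by_cases p1 : P (φ 1) <;> simp_all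

namespace SimplexificationVertex

variable {α : Type u} {β : Type v} {T₁ : SimpleGraph α} {T₂ : SimpleGraph β}

/-- Two vertices of the simplexification are near if they coincide or span an edge. -/
def Near (x y : SimplexificationVertex T₁ T₂) : Prop := ∃ F, IsCell F ∧ x ∈ F ∧ y ∈ F

theorem Near.symm {x y : SimplexificationVertex T₁ T₂} : Near x y → Near y x :=
  fun ⟨F, hF, hx, hy⟩ => ⟨F, hF, hy, hx⟩

theorem near_comm {x y : SimplexificationVertex T₁ T₂} : Near x y ↔ Near y x := ⟨.symm, .symm⟩

theorem Near.refl (x : SimplexificationVertex T₁ T₂) : Near x x := by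
  obtain ⟨-, F, hF, h⟩ := mem_faces_iff.1 ((simplexification T₁ T₂).singleton_mem x)
  exact ⟨F, hF, h (by simp), h (by simp)⟩

theorem near_vertex_vertex {a a' : α} {b b' : β} :
    Near (vertex a b : SimplexificationVertex T₁ T₂) (vertex a' b') ↔
      b = b' ∧ (a = a' ∨ T₁.Adj a a') := by
  constructor
  · rintro ⟨F, hF, h1, h2⟩
    have hfst := hF.fst_close h1 h2 rfl
    simp only [fstSet_vertex, Set.mem_singleton_iff, exists_eq_left] at hfst
    refine ⟨?_, hfst⟩
    rcases hF with ⟨a, b⟩ | ⟨e, b⟩ | ⟨e, f, b, hb⟩ | ⟨a, f, b, hb⟩ <;>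
    simp_all [horizontalEdgeSimplex, triangleSimplex, verticalEdgeSimplex]
  · rintro ⟨rfl, rfl | h⟩
    · exact Near.refl _
    · exact ⟨_, .horizontal ⟨s(a, a'), h⟩ b, vertex_mem_horizontal (Sym2.mem_mk_left _ _),
        vertex_mem_horizontal (Sym2.mem_mk_right _ _)⟩

theorem near_vertex_verticalEdge {a a' : α} {b : β} {f : T₂.edgeSet} :
    Near (vertex a b : SimplexificationVertex T₁ T₂) (verticalEdge a' f) ↔
      a = a' ∧ b ∈ (f : Sym2 β) := by
  constructor
  · rintro ⟨F, hF, h1, h2⟩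
    rcases hF with ⟨a, b⟩ | ⟨e, b⟩ | ⟨e, f, b, hb⟩ | ⟨a, f, b, hb⟩ <;>
    simp_all [horizontalEdgeSimplex, triangleSimplex, verticalEdgeSimplex]
  · rintro ⟨rfl, h⟩
    exact ⟨_, .vertical a f b h, vertex_mem_vertical, verticalEdge_mem_vertical⟩

theorem near_vertex_square {a : α} {b : β} {e : T₁.edgeSet} {f : T₂.edgeSet} :
    Near (vertex a b) (square e f) ↔ a ∈ (e : Sym2 α) ∧ b ∈ (f : Sym2 β) := by
  constructor
  · rintro ⟨F, hF, h1, h2⟩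
    rcases hF with ⟨a, b⟩ | ⟨e, b⟩ | ⟨e, f, b, hb⟩ | ⟨a, f, b, hb⟩ <;>
    simp_all [horizontalEdgeSimplex, triangleSimplex, verticalEdgeSimplex]
  · rintro ⟨h, h'⟩
    exact ⟨_, .vertical a f b h', vertex_mem_vertical, square_mem_vertical h⟩

theorem near_verticalEdge_verticalEdge {a a' : α} {f f' : T₂.edgeSet} :
    Near (verticalEdge a f : SimplexificationVertex T₁ T₂) (verticalEdge a' f') ↔
      a = a' ∧ f = f' := by
  constructor
  · rintro ⟨F, hF, h1, h2⟩
    rcases hF with ⟨a, b⟩ | ⟨e, b⟩ | ⟨e, f, b, hb⟩ | ⟨a, f, b, hb⟩ <;>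
    simp_all [horizontalEdgeSimplex, triangleSimplex, verticalEdgeSimplex]
  · rintro ⟨rfl, rfl⟩
    exact Near.refl _

theorem near_verticalEdge_square {a : α} {e : T₁.edgeSet} {f f' : T₂.edgeSet} :
    Near (verticalEdge a f) (square e f') ↔ a ∈ (e : Sym2 α) ∧ f = f' := by
  constructor
  · rintro ⟨F, hF, h1, h2⟩
    rcases hF with ⟨a, b⟩ | ⟨e, b⟩ | ⟨e, f, b, hb⟩ | ⟨a, f, b, hb⟩ <;>
    simp_all [horizontalEdgeSimplex, triangleSimplex, verticalEdgeSimplex]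
  · rintro ⟨h, rfl⟩
    exact ⟨_, .vertical a f _ (Sym2.out_fst_mem _), verticalEdge_mem_vertical,
      square_mem_vertical h⟩

theorem near_square_square {e e' : T₁.edgeSet} {f f' : T₂.edgeSet} :
    Near (square e f) (square e' f') ↔
      (∃ a, a ∈ (e : Sym2 α) ∧ a ∈ (e' : Sym2 α)) ∧ f = f' := by
  constructor
  · rintro ⟨F, hF, h1, h2⟩
    rcases hF with ⟨a, b⟩ | ⟨e, b⟩ | ⟨e, f, b, hb⟩ | ⟨a, f, b, hb⟩
    · simp_all
    · simp_all [horizontalEdgeSimplex]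
    · simp_all [horizontalEdgeSimplex, triangleSimplex]
      exact ⟨_, Sym2.out_fst_mem _⟩
    · simp_all [verticalEdgeSimplex]
      exact ⟨a, h1.1, h2.1⟩
  · rintro ⟨⟨a, h, h'⟩, rfl⟩
    exact ⟨_, .vertical a f _ (Sym2.out_fst_mem _), square_mem_vertical h, square_mem_vertical h'⟩

theorem _root_.SimpleGraph.edge_eq_of_mem {γ : Type*} {T : SimpleGraph γ} {e e' : T.edgeSet}
    {a a' : γ} (hne : a ≠ a') (ha : a ∈ (e : Sym2 γ)) (ha' : a' ∈ (e : Sym2 γ))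
    (hb : a ∈ (e' : Sym2 γ)) (hb' : a' ∈ (e' : Sym2 γ)) : e = e' :=
  Subtype.ext (((Sym2.mem_and_mem_iff hne).1 ⟨ha, ha'⟩).trans
    ((Sym2.mem_and_mem_iff hne).1 ⟨hb, hb'⟩).symm)

theorem _root_.SimpleGraph.eq_or_eq_of_mem {γ : Type*} {T : SimpleGraph γ} {e : T.edgeSet}
    {a a' c : γ} (hne : a ≠ a') (ha : a ∈ (e : Sym2 γ)) (ha' : a' ∈ (e : Sym2 γ))
    (hc : c ∈ (e : Sym2 γ)) : c = a ∨ c = a' := by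
  rw [(Sym2.mem_and_mem_iff hne).1 ⟨ha, ha'⟩] at hc
  exact Sym2.mem_iff.1 hc

theorem _root_.SimpleGraph.exists_edge_ends {γ : Type*} {T : SimpleGraph γ} (e : T.edgeSet) :
    ∃ a a', a ≠ a' ∧ a ∈ (e : Sym2 γ) ∧ a' ∈ (e : Sym2 γ) := by
  obtain ⟨e, he⟩ := e
  induction e using Sym2.ind with
  | _ a b => exact ⟨a, b, T.ne_of_adj he, Sym2.mem_mk_left _ _, Sym2.mem_mk_right _ _⟩

/-- Pairwise intersecting edges of a triangle-free graph have a common endpoint. -/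
theorem exists_common_endpoint (htri : ∀ a b c, T₁.Adj a b → T₁.Adj b c → ¬ T₁.Adj a c)
    {E : Set T₁.edgeSet} (hne : E.Nonempty)
    (hE : ∀ e ∈ E, ∀ e' ∈ E, ∃ a, a ∈ (e : Sym2 α) ∧ a ∈ (e' : Sym2 α)) :
    ∃ a, ∀ e ∈ E, a ∈ (e : Sym2 α) := by
  obtain ⟨e₀, he₀⟩ := hne
  obtain ⟨a, a', haa', ha, ha'⟩ := SimpleGraph.exists_edge_ends e₀
  by_contra! h
  obtain ⟨e₁, he₁, h₁⟩ := h a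
  obtain ⟨e₂, he₂, h₂⟩ := h a'
  have h₁' : a' ∈ (e₁ : Sym2 α) := by
    obtain ⟨c, hc, hc'⟩ := hE e₀ he₀ e₁ he₁
    rcases SimpleGraph.eq_or_eq_of_mem haa' ha ha' hc with rfl | rfl
    · exact absurd hc' h₁
    · exact hc'
  have h₂' : a ∈ (e₂ : Sym2 α) := by
    obtain ⟨c, hc, hc'⟩ := hE e₀ he₀ e₂ he₂
    rcases SimpleGraph.eq_or_eq_of_mem haa' ha ha' hc with rfl | rfl
    · exact hc'
    · exact absurd hc' h₂
  obtain ⟨c, hc₁, hc₂⟩ := hE e₁ he₁ e₂ he₂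
  have hca : c ≠ a := fun h => h₁ (h ▸ hc₁)
  have hca' : c ≠ a' := fun h => h₂ (h ▸ hc₂)
  exact htri a a' c (SimpleGraph.adj_of_mem_edge ha ha' haa')
    (SimpleGraph.adj_of_mem_edge h₁' hc₁ hca'.symm) (SimpleGraph.adj_of_mem_edge h₂' hc₂ hca.symm)

/-- The simplexification is a flag complex when the first graph has no triangles. -/
theorem exists_cell_of_pairwise_near
    (htri : ∀ a b c, T₁.Adj a b → T₁.Adj b c → ¬ T₁.Adj a c)
    {s : Set (SimplexificationVertex T₁ T₂)} (hne : s.Nonempty)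
    (hs : ∀ x ∈ s, ∀ y ∈ s, Near x y) : ∃ F, IsCell F ∧ s ⊆ F := by
  by_cases hv : ∃ a f, verticalEdge a f ∈ s
  · obtain ⟨a, f, haf⟩ := hv
    -- the vertices of `s` which are vertices of the product coincide
    obtain ⟨b, hb, hsb⟩ : ∃ b ∈ (f : Sym2 β), ∀ a' b', vertex a' b' ∈ s → b' = b := by
      by_cases h : ∃ a' b', vertex a' b' ∈ s
      · obtain ⟨a', b, h⟩ := h
        exact ⟨b, (near_vertex_verticalEdge.1 (hs _ h _ haf)).2, fun a'' b' h' =>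
          (near_vertex_vertex.1 (hs _ h' _ h)).1⟩
      · exact ⟨_, Sym2.out_fst_mem _, fun a' b' h' => absurd ⟨a', b', h'⟩ h⟩
    refine ⟨_, .vertical a f b hb, ?_⟩
    rintro (⟨a', b'⟩ | ⟨a', f'⟩ | ⟨e, f'⟩) hc
    · obtain ⟨rfl, -⟩ := near_vertex_verticalEdge.1 (hs _ hc _ haf)
      rw [hsb _ _ hc]
      exact vertex_mem_vertical
    · obtain ⟨rfl, rfl⟩ := near_verticalEdge_verticalEdge.1 (hs _ hc _ haf)
      exact verticalEdge_mem_vertical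
    · obtain ⟨ha, rfl⟩ := near_verticalEdge_square.1 (hs _ haf _ hc)
      exact square_mem_vertical ha
  · have hsq : ∀ e f e' f', square e f ∈ s → square e' f' ∈ s → f = f' := fun e f e' f' h h' =>
      (near_square_square.1 (hs _ h _ h')).2
    by_cases hab : ∃ a b, vertex a b ∈ s
    · obtain ⟨a, b, hab⟩ := hab
      by_cases hab' : ∃ a' b', vertex a' b' ∈ s ∧ a' ≠ a
      · obtain ⟨a', b', hab', hne⟩ := hab'
        obtain ⟨rfl, h | h⟩ := near_vertex_vertex.1 (hs _ hab _ hab')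
        · exact absurd h.symm hne
        have ha : a ∈ s(a, a') := Sym2.mem_mk_left _ _
        have ha' : a' ∈ s(a, a') := Sym2.mem_mk_right _ _
        have hvert : ∀ a'' b'', vertex a'' b'' ∈ s → a'' ∈ s(a, a') ∧ b'' = b := by
          intro a'' b'' hc
          obtain ⟨rfl, h1⟩ := near_vertex_vertex.1 (hs _ hc _ hab)
          obtain ⟨-, h2⟩ := near_vertex_vertex.1 (hs _ hc _ hab')
          refine ⟨?_, rfl⟩
          rcases h1 with rfl | h1
          · exact ha
          · rcases h2 with rfl | h2
            · exact ha'
            · exact absurd h2 (htri _ _ _ h1 h)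
        have hsquare : ∀ e f, square e f ∈ s → e = ⟨s(a, a'), h⟩ ∧ b ∈ (f : Sym2 β) := by
          intro e f hc
          obtain ⟨h1, h2⟩ := near_vertex_square.1 (hs _ hab _ hc)
          obtain ⟨h3, -⟩ := near_vertex_square.1 (hs _ hab' _ hc)
          exact ⟨SimpleGraph.edge_eq_of_mem hne.symm h1 h3 ha ha', h2⟩
        by_cases hef : ∃ e f, square e f ∈ s
        · obtain ⟨e, f, hef⟩ := hef
          refine ⟨_, .triangle ⟨s(a, a'), h⟩ f b (hsquare e f hef).2, ?_⟩
          rintro (⟨a'', b''⟩ | ⟨a'', f'⟩ | ⟨e', f'⟩) hc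
          · obtain ⟨h1, rfl⟩ := hvert _ _ hc
            exact vertex_mem_triangle h1
          · exact absurd ⟨_, _, hc⟩ hv
          · obtain rfl := hsq _ _ _ _ hc hef
            rw [(hsquare _ _ hc).1]
            exact square_mem_triangle
        · refine ⟨_, .horizontal ⟨s(a, a'), h⟩ b, ?_⟩
          rintro (⟨a'', b''⟩ | ⟨a'', f'⟩ | ⟨e', f'⟩) hc
          · obtain ⟨h1, rfl⟩ := hvert _ _ hc
            exact vertex_mem_horizontal h1
          · exact absurd ⟨_, _, hc⟩ hv
          · exact absurd ⟨_, _, hc⟩ hef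
      · push Not at hab'
        have hvert : ∀ a'' b'', vertex a'' b'' ∈ s → a'' = a ∧ b'' = b := fun a'' b'' hc =>
          ⟨hab' _ _ hc, (near_vertex_vertex.1 (hs _ hc _ hab)).1⟩
        by_cases hef : ∃ e f, square e f ∈ s
        · obtain ⟨e, f, hef⟩ := hef
          refine ⟨_, .vertical a f b (near_vertex_square.1 (hs _ hab _ hef)).2, ?_⟩
          rintro (⟨a'', b''⟩ | ⟨a'', f'⟩ | ⟨e', f'⟩) hc
          · obtain ⟨rfl, rfl⟩ := hvert _ _ hc
            exact vertex_mem_vertical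
          · exact absurd ⟨_, _, hc⟩ hv
          · obtain rfl := hsq _ _ _ _ hc hef
            exact square_mem_vertical (near_vertex_square.1 (hs _ hab _ hc)).1
        · refine ⟨_, .point a b, ?_⟩
          rintro (⟨a'', b''⟩ | ⟨a'', f'⟩ | ⟨e', f'⟩) hc
          · obtain ⟨rfl, rfl⟩ := hvert _ _ hc
            rfl
          · exact absurd ⟨_, _, hc⟩ hv
          · exact absurd ⟨_, _, hc⟩ hef
    · obtain ⟨e, f, hef⟩ : ∃ e f, square e f ∈ s := by
        obtain ⟨⟨a, b⟩ | ⟨a, f⟩ | ⟨e, f⟩, hc⟩ := hne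
        · exact absurd ⟨_, _, hc⟩ hab
        · exact absurd ⟨_, _, hc⟩ hv
        · exact ⟨e, f, hc⟩
      obtain ⟨a, ha⟩ := exists_common_endpoint htri (E := {e | ∃ f, square e f ∈ s}) ⟨e, f, hef⟩
        fun e ⟨f, he⟩ e' ⟨f', he'⟩ => (near_square_square.1 (hs _ he _ he')).1
      refine ⟨_, .vertical a f _ (Sym2.out_fst_mem _), ?_⟩
      rintro (⟨a'', b''⟩ | ⟨a'', f'⟩ | ⟨e', f'⟩) hc
      · exact absurd ⟨_, _, hc⟩ hab
      · exact absurd ⟨_, _, hc⟩ hv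
      · obtain rfl := hsq _ _ _ _ hc hef
        exact square_mem_vertical (ha _ ⟨_, hc⟩)

theorem link_singleton_mem_iff {v x : SimplexificationVertex T₁ T₂} :
    {x} ∈ ((simplexification T₁ T₂).link v).faces ↔ x ≠ v ∧ Near v x := by
  constructor
  · rintro ⟨-, hv, h⟩
    obtain ⟨-, F, hF, hsF⟩ := mem_faces_iff.1 h
    exact ⟨fun h => hv (by simp [h]), F, hF, hsF (by simp), hsF (by simp)⟩
  · rintro ⟨hne, F, hF, h1, h2⟩
    refine ⟨Finset.singleton_nonempty _, fun h => hne (Finset.mem_singleton.1 h).symm,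
      mem_faces_iff.2 ⟨Finset.cons_nonempty _, F, hF, ?_⟩⟩
    intro c hc
    simp only [Finset.coe_cons, Finset.coe_singleton, Set.mem_insert_iff,
      Set.mem_singleton_iff] at hc
    rcases hc with rfl | rfl <;> assumption

theorem near_of_link_adj {v x y : SimplexificationVertex T₁ T₂}
    (h : ((simplexification T₁ T₂).link v).oneSkeleton.Adj x y) :
    x ≠ y ∧ x ≠ v ∧ Near v x ∧ Near x y := by
  obtain ⟨hne, s, ⟨-, hv, hs⟩, hx, hy⟩ := h
  obtain ⟨-, F, hF, hsF⟩ := mem_faces_iff.1 hs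
  have hx' : x ∈ F := hsF (by simp [hx])
  exact ⟨hne, fun h => hv (h ▸ hx), ⟨F, hF, hsF (by simp), hx'⟩, F, hF, hx', hsF (by simp [hy])⟩

theorem link_mem_of_pairwise_near
    (htri : ∀ a b c, T₁.Adj a b → T₁.Adj b c → ¬ T₁.Adj a c)
    {v : SimplexificationVertex T₁ T₂} {s : Finset (SimplexificationVertex T₁ T₂)}
    (hne : s.Nonempty) (hv : ∀ x ∈ s, x ≠ v ∧ Near v x) (hs : ∀ x ∈ s, ∀ y ∈ s, Near x y) :
    s ∈ ((simplexification T₁ T₂).link v).faces := by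
  refine ⟨hne, fun h => (hv v h).1 rfl, mem_faces_iff.2 ⟨Finset.cons_nonempty _, ?_⟩⟩
  refine exists_cell_of_pairwise_near htri ⟨v, by simp⟩ fun x hx y hy => ?_
  simp only [Finset.coe_cons, Set.mem_insert_iff, Finset.mem_coe] at hx hy
  rcases hx with rfl | hx <;> rcases hy with rfl | hy
  · exact Near.refl _
  · exact (hv y hy).2
  · exact (hv x hx).2.symm
  · exact hs x hx y hy

/-- Whether an element is an original vertex of the product of the two graphs. -/
def IsVertex : SimplexificationVertex T₁ T₂ → Prop
  | vertex _ _ => True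
  | _ => False

theorem near_verticalEdge_vertex {a a' : α} {b : β} {f : T₂.edgeSet} :
    Near (verticalEdge a' f : SimplexificationVertex T₁ T₂) (vertex a b) ↔
      a = a' ∧ b ∈ (f : Sym2 β) := near_comm.trans near_vertex_verticalEdge

theorem near_square_vertex {a : α} {b : β} {e : T₁.edgeSet} {f : T₂.edgeSet} :
    Near (square e f) (vertex a b) ↔ a ∈ (e : Sym2 α) ∧ b ∈ (f : Sym2 β) :=
  near_comm.trans near_vertex_square

theorem near_square_verticalEdge {a : α} {e : T₁.edgeSet} {f f' : T₂.edgeSet} :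
    Near (square e f') (verticalEdge a f) ↔ a ∈ (e : Sym2 α) ∧ f = f' :=
  near_comm.trans near_verticalEdge_square

/-- In the link of a vertex `(a, b)` the induced paths have period three: the neighbours `(a', b)`
are pairwise nonadjacent, and the other neighbours split into cliques, one for each vertical edge
at `(a, b)`, in which every square has exactly one neighbour `(a', b)`. -/
theorem period_three_link_vertex (htri : ∀ a b c, T₁.Adj a b → T₁.Adj b c → ¬ T₁.Adj a c)
    {a : α} {b : β} {x y z : SimplexificationVertex T₁ T₂}
    (hx : x ≠ vertex a b) (hy : y ≠ vertex a b) (hz : z ≠ vertex a b)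
    (hvx : Near (vertex a b) x) (hvy : Near (vertex a b) y) (hvz : Near (vertex a b) z)
    (hxy : Near x y) (hyz : Near y z) (hxyne : x ≠ y) (hyzne : y ≠ z) (hne : x ≠ z)
    (hxz : ¬ Near x z) :
    (y.IsVertex → ¬ x.IsVertex) ∧ (¬ y.IsVertex → (x.IsVertex ↔ ¬ z.IsVertex)) := by
  have hvert : ∀ {a' b'}, (vertex a' b' : SimplexificationVertex T₁ T₂) ≠ vertex a b →
      Near (vertex a b : SimplexificationVertex T₁ T₂) (vertex a' b') → b' = b ∧ T₁.Adj a a' :=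
    fun {a' b'} h h' => by
      obtain ⟨rfl, rfl | h''⟩ := near_vertex_vertex.1 h'
      · exact absurd rfl h
      · exact ⟨rfl, h''⟩
  rcases y with ⟨a', b'⟩ | ⟨a', f⟩ | ⟨e, f⟩
  · obtain ⟨rfl, hadj⟩ := hvert hy hvy
    refine ⟨fun _ hx' => ?_, fun h => absurd trivial h⟩
    rcases x with ⟨a'', b''⟩ | ⟨a'', f'⟩ | ⟨e', f'⟩
    · obtain ⟨rfl, hadj'⟩ := hvert hx hvx
      rcases (near_vertex_vertex.1 hxy).2 with rfl | h
      · exact hxyne rfl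
      · exact htri _ _ _ hadj' h hadj
    · exact hx'
    · exact hx'
  · refine ⟨fun h => h.elim, fun _ => ?_⟩
    have key : ∀ w : SimplexificationVertex T₁ T₂, w ≠ vertex a b → w ≠ verticalEdge a' f →
        Near (vertex a b) w → Near w (verticalEdge a' f) →
        ∃ e, w = square e f ∧ a' ∈ (e : Sym2 α) := by
      rintro (⟨a'', b''⟩ | ⟨a'', f'⟩ | ⟨e', f'⟩) h1 h2 h3 h4
      · obtain ⟨rfl, -⟩ := near_vertex_verticalEdge.1 h4
        obtain ⟨rfl, -⟩ := near_vertex_verticalEdge.1 hvy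
        exact absurd (hvert h1 h3).2 (T₁.loopless.irrefl _)
      · obtain ⟨rfl, rfl⟩ := near_verticalEdge_verticalEdge.1 h4
        exact absurd rfl h2
      · obtain ⟨h5, rfl⟩ := near_square_verticalEdge.1 h4
        exact ⟨e', rfl, h5⟩
    obtain ⟨e, rfl, he⟩ := key x hx hxyne hvx hxy
    obtain ⟨e', rfl, he'⟩ := key z hz hyzne.symm hvz hyz.symm
    exact absurd (near_square_square.2 ⟨⟨a', he, he'⟩, rfl⟩) hxz
  · refine ⟨fun h => h.elim, fun _ => ?_⟩
    obtain ⟨hae, hbf⟩ := near_vertex_square.1 hvy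
    have key : ∀ w : SimplexificationVertex T₁ T₂, w ≠ vertex a b →
        Near (vertex a b) w → Near w (square e f) →
        (∃ a', w = vertex a' b ∧ a' ≠ a ∧ a' ∈ (e : Sym2 α)) ∨ w = verticalEdge a f ∨
          ∃ e', w = square e' f ∧ a ∈ (e' : Sym2 α) := by
      rintro (⟨a'', b''⟩ | ⟨a'', f'⟩ | ⟨e', f'⟩) h1 h3 h4
      · obtain ⟨rfl, h⟩ := hvert h1 h3
        exact Or.inl ⟨a'', rfl, (T₁.ne_of_adj h).symm, (near_vertex_square.1 h4).1⟩
      · obtain ⟨rfl, -⟩ := near_vertex_verticalEdge.1 h3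
        obtain ⟨-, rfl⟩ := near_verticalEdge_square.1 h4
        exact Or.inr (Or.inl rfl)
      · obtain ⟨h5, -⟩ := near_vertex_square.1 h3
        obtain ⟨-, rfl⟩ := near_square_square.1 h4
        exact Or.inr (Or.inr ⟨e', rfl, h5⟩)
    rcases key x hx hvx hxy with ⟨a₁, rfl, h1, h1'⟩ | rfl | ⟨e₁, rfl, h1⟩ <;>
    rcases key z hz hvz hyz.symm with ⟨a₂, rfl, h2, h2'⟩ | rfl | ⟨e₂, rfl, h2⟩
    · refine absurd ?_ hne
      rcases SimpleGraph.eq_or_eq_of_mem h1.symm hae h1' h2' with h | h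
      · exact absurd h h2
      · rw [h]
    · exact iff_of_true trivial id
    · exact iff_of_true trivial id
    · exact iff_of_false id fun h => h trivial
    · exact absurd rfl hne
    · exact absurd (near_verticalEdge_square.2 ⟨h2, rfl⟩) hxz
    · exact iff_of_false id fun h => h trivial
    · exact absurd (near_square_verticalEdge.2 ⟨h1, rfl⟩) hxz
    · exact absurd (near_square_square.2 ⟨⟨a, h1, h2⟩, rfl⟩) hxz

/-- The link of the midpoint of a vertical edge is a suspension of a simplex: its squares are
adjacent to everything, and two distinct vertices are not adjacent. -/
theorem period_three_link_verticalEdge {a : α} {f : T₂.edgeSet}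
    {x y z : SimplexificationVertex T₁ T₂}
    (hx : x ≠ verticalEdge a f) (hy : y ≠ verticalEdge a f) (hz : z ≠ verticalEdge a f)
    (hvx : Near (verticalEdge a f) x) (hvy : Near (verticalEdge a f) y)
    (hvz : Near (verticalEdge a f) z)
    (hxy : Near x y) (hyz : Near y z) (hxyne : x ≠ y) (hyzne : y ≠ z) (hxz : ¬ Near x z) :
    (¬ y.IsVertex → ¬ ¬ x.IsVertex) ∧ (¬ ¬ y.IsVertex → (¬ x.IsVertex ↔ ¬ ¬ z.IsVertex)) := by
  have key : ∀ w : SimplexificationVertex T₁ T₂, w ≠ verticalEdge a f →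
      Near (verticalEdge a f) w → (∃ b, w = vertex a b ∧ b ∈ (f : Sym2 β)) ∨
        ∃ e, w = square e f ∧ a ∈ (e : Sym2 α) := by
    rintro (⟨a'', b''⟩ | ⟨a'', f'⟩ | ⟨e', f'⟩) h1 h2
    · obtain ⟨rfl, h⟩ := near_verticalEdge_vertex.1 h2
      exact Or.inl ⟨_, rfl, h⟩
    · obtain ⟨rfl, rfl⟩ := near_verticalEdge_verticalEdge.1 h2
      exact absurd rfl h1
    · obtain ⟨h, rfl⟩ := near_verticalEdge_square.1 h2
      exact Or.inr ⟨_, rfl, h⟩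
  rcases key x hx hvx with ⟨b₁, rfl, h1⟩ | ⟨e₁, rfl, h1⟩ <;>
  rcases key z hz hvz with ⟨b₂, rfl, h2⟩ | ⟨e₂, rfl, h2⟩
  · refine ⟨fun _ h => h trivial, fun hy' => ?_⟩
    rcases key y hy hvy with ⟨b₃, rfl, h3⟩ | ⟨e₃, rfl, h3⟩
    · rw [(near_vertex_vertex.1 hxy).1] at hxyne
      exact absurd rfl hxyne
    · exact absurd id hy'
  · exact absurd (near_vertex_square.2 ⟨h2, h1⟩) hxz
  · exact absurd (near_square_vertex.2 ⟨h1, h2⟩) hxz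
  · exact absurd (near_square_square.2 ⟨⟨a, h1, h2⟩, rfl⟩) hxz

/-- In the link of the centre of a square `(e, f)` every element lies over exactly one endpoint of
`e`. Elements over the same endpoint are adjacent, except for the two vertices of the square, and
elements over different endpoints are adjacent only if they are vertices of the square on a common
horizontal edge. -/
theorem period_three_link_square (htri : ∀ a b c, T₁.Adj a b → T₁.Adj b c → ¬ T₁.Adj a c)
    {e : T₁.edgeSet} {f : T₂.edgeSet} {x y z : SimplexificationVertex T₁ T₂}
    (hx : x ≠ square e f) (hy : y ≠ square e f) (hz : z ≠ square e f)
    (hvx : Near (square e f) x) (hvy : Near (square e f) y) (hvz : Near (square e f) z)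
    (hxy : Near x y) (hyz : Near y z) (hxyne : x ≠ y) (hyzne : y ≠ z) (hne : x ≠ z)
    (hxz : ¬ Near x z) :
    (¬ y.IsVertex → ¬ ¬ x.IsVertex) ∧ (¬ ¬ y.IsVertex → (¬ x.IsVertex ↔ ¬ ¬ z.IsVertex)) := by
  -- the elements of the link which lie over the endpoint `a` of `e`
  let Over (a : α) (w : SimplexificationVertex T₁ T₂) : Prop :=
    (∃ b, w = vertex a b ∧ b ∈ (f : Sym2 β)) ∨ w = verticalEdge a f ∨
      ∃ e', w = square e' f ∧ a ∈ (e' : Sym2 α) ∧ e' ≠ e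
  have hover : ∀ w : SimplexificationVertex T₁ T₂, w ≠ square e f → Near (square e f) w →
      ∃ a ∈ (e : Sym2 α), Over a w := by
    rintro (⟨a, b⟩ | ⟨a, f'⟩ | ⟨e', f'⟩) h1 h2
    · obtain ⟨h3, h4⟩ := near_square_vertex.1 h2
      exact ⟨a, h3, Or.inl ⟨b, rfl, h4⟩⟩
    · obtain ⟨h3, rfl⟩ := near_square_verticalEdge.1 h2
      exact ⟨a, h3, Or.inr (Or.inl rfl)⟩
    · obtain ⟨⟨a, h3, h4⟩, rfl⟩ := near_square_square.1 h2
      exact ⟨a, h3, Or.inr (Or.inr ⟨e', rfl, h4, fun h => h1 (h ▸ rfl)⟩)⟩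
  have hsame : ∀ {a w w'}, Over a w → Over a w' → ¬ (w.IsVertex ∧ w'.IsVertex) → Near w w' := by
    rintro a w w' (⟨b₁, rfl, h1⟩ | rfl | ⟨e₁, rfl, h1, -⟩)
      (⟨b₂, rfl, h2⟩ | rfl | ⟨e₂, rfl, h2, -⟩) hnv
    · exact absurd ⟨trivial, trivial⟩ hnv
    · exact near_vertex_verticalEdge.2 ⟨rfl, h1⟩
    · exact near_vertex_square.2 ⟨h2, h1⟩
    · exact near_verticalEdge_vertex.2 ⟨rfl, h2⟩
    · exact Near.refl _
    · exact near_verticalEdge_square.2 ⟨h2, rfl⟩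
    · exact near_square_vertex.2 ⟨h1, h2⟩
    · exact near_square_verticalEdge.2 ⟨h1, rfl⟩
    · exact near_square_square.2 ⟨⟨a, h1, h2⟩, rfl⟩
  have hnot : ∀ {a a' : α} {e' : T₁.edgeSet}, a ∈ (e : Sym2 α) → a' ∈ (e : Sym2 α) →
      a ∈ (e' : Sym2 α) → a' ∈ (e' : Sym2 α) → e' ≠ e → a = a' := by
    intro a a' e' h1 h2 h3 h4 h5
    by_contra h
    exact h5 (SimpleGraph.edge_eq_of_mem h h3 h4 h1 h2)
  have hdiff : ∀ {a a' w w'}, a ∈ (e : Sym2 α) → a' ∈ (e : Sym2 α) → Over a w → Over a' w' →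
      Near w w' → ¬ (w.IsVertex ∧ w'.IsVertex) → a = a' := by
    rintro a a' w w' ha ha' (⟨b₁, rfl, h1⟩ | rfl | ⟨e₁, rfl, h1, h1'⟩)
      (⟨b₂, rfl, h2⟩ | rfl | ⟨e₂, rfl, h2, h2'⟩) hn hnv
    · exact absurd ⟨trivial, trivial⟩ hnv
    · exact (near_vertex_verticalEdge.1 hn).1
    · exact hnot ha ha' (near_vertex_square.1 hn).1 h2 h2'
    · exact (near_verticalEdge_vertex.1 hn).1.symm
    · exact (near_verticalEdge_verticalEdge.1 hn).1
    · exact hnot ha ha' (near_verticalEdge_square.1 hn).1 h2 h2'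
    · exact hnot ha ha' h1 (near_square_vertex.1 hn).1 h1'
    · exact hnot ha ha' h1 (near_square_verticalEdge.1 hn).1 h1'
    · -- two edges through different endpoints of `e` which meet would form a triangle with `e`
      by_contra h
      obtain ⟨c, hc1, hc2⟩ := (near_square_square.1 hn).1
      have hca : a ≠ c := fun h' => h (hnot ha ha' (h' ▸ hc2) h2 h2')
      have hca' : a' ≠ c := fun h' => h (hnot ha ha' h1 (h' ▸ hc1) h1')
      exact htri a a' c (SimpleGraph.adj_of_mem_edge ha ha' h)
        (SimpleGraph.adj_of_mem_edge h2 hc2 hca') (SimpleGraph.adj_of_mem_edge h1 hc1 hca)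
  obtain ⟨a₁, ha₁, h1⟩ := hover x hx hvx
  obtain ⟨a₂, ha₂, h2⟩ := hover y hy hvy
  obtain ⟨a₃, ha₃, h3⟩ := hover z hz hvz
  refine ⟨fun hyv hxv => ?_, fun hyv => ?_⟩
  · obtain rfl := hdiff ha₁ ha₂ h1 h2 hxy fun h => hxv h.1
    obtain rfl := hdiff ha₁ ha₃ h2 h3 hyz fun h => hyv h.1
    exact hxz (hsame h1 h3 fun h => hxv h.1)
  · by_cases hxv : x.IsVertex <;> by_cases hzv : z.IsVertex
    · -- both would be the other corner of the square on the horizontal edge at the corner `y`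
      refine absurd ?_ hne
      rcases h1 with ⟨b₁, rfl, h1⟩ | rfl | ⟨e₁, rfl, h1, h1'⟩
      · rcases h2 with ⟨b₂, rfl, h2⟩ | rfl | ⟨e₂, rfl, h2, h2'⟩
        · rcases h3 with ⟨b₃, rfl, h3⟩ | rfl | ⟨e₃, rfl, h3, h3'⟩
          · obtain ⟨rfl, hadj⟩ := near_vertex_vertex.1 hxy
            obtain ⟨rfl, hadj'⟩ := near_vertex_vertex.1 hyz
            have h12 : a₁ ≠ a₂ := fun h => hxyne (h ▸ rfl)
            have h23 : a₂ ≠ a₃ := fun h => hyzne (h ▸ rfl)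
            rcases SimpleGraph.eq_or_eq_of_mem h12 ha₁ ha₂ ha₃ with rfl | rfl
            · rfl
            · exact absurd rfl h23
          · exact hzv.elim
          · exact hzv.elim
        · exact absurd id hyv
        · exact absurd id hyv
      · exact hxv.elim
      · exact hxv.elim
    · exact iff_of_false (fun h => h hxv) fun h => h hzv
    · exact iff_of_true hxv fun h => h hzv
    · exfalso
      obtain rfl := hdiff ha₁ ha₂ h1 h2 hxy fun h => hxv h.1
      obtain rfl := hdiff ha₁ ha₃ h2 h3 hyz fun h => hzv h.2
      exact hxz (hsame h1 h3 fun h => hxv h.1)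

theorem isLocallySixLarge (htri : ∀ a b c, T₁.Adj a b → T₁.Adj b c → ¬ T₁.Adj a c) :
    (simplexification T₁ T₂).IsLocallySixLarge := by
  intro v
  constructor
  · intro s hne hv hs
    refine link_mem_of_pairwise_near htri hne (fun x hx => link_singleton_mem_iff.1 (hv x hx))
      fun x hx y hy => ?_
    by_cases hxy : x = y
    · exact hxy ▸ Near.refl x
    · exact (near_of_link_adj (hs x hx y hy hxy)).2.2.2
  · have hnadj : ∀ {x y : SimplexificationVertex T₁ T₂}, x ≠ y → x ≠ v → y ≠ v → Near v x →
        Near v y → ¬ ((simplexification T₁ T₂).link v).oneSkeleton.Adj x y → ¬ Near x y := by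
      classical
      intro x y hxy hx hy hvx hvy h hn
      refine h ⟨hxy, {x, y}, link_mem_of_pairwise_near htri ⟨x, by simp⟩ ?_ ?_, by simp, by simp⟩
      · intro w hw
        rcases Finset.mem_insert.1 hw with rfl | hw
        · exact ⟨hx, hvx⟩
        · rw [Finset.mem_singleton.1 hw]
          exact ⟨hy, hvy⟩
      · intro w hw w' hw'
        rw [Finset.mem_insert, Finset.mem_singleton] at hw hw'
        rcases hw with rfl | rfl <;> rcases hw' with rfl | rfl
        · exact Near.refl _
        · exact hn
        · exact hn.symm
        · exact Near.refl _
    rcases v with ⟨a, b⟩ | ⟨a, f⟩ | ⟨e, f⟩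
    · refine SimpleGraph.not_cycleGraph_embedding_of_period_three IsVertex
        fun x y z hxy hyz hne hxz => ?_
      obtain ⟨h1, h2, h3, h4⟩ := near_of_link_adj hxy
      obtain ⟨h5, h6, h7, h8⟩ := near_of_link_adj hyz
      obtain ⟨-, h9, h10, -⟩ := near_of_link_adj hyz.symm
      exact period_three_link_vertex htri h2 h6 h9 h3 h7 h10 h4 h8 h1 h5 hne
        (hnadj hne h2 h9 h3 h10 hxz)
    · refine SimpleGraph.not_cycleGraph_embedding_of_period_three (fun x => ¬ x.IsVertex)
        fun x y z hxy hyz hne hxz => ?_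
      obtain ⟨h1, h2, h3, h4⟩ := near_of_link_adj hxy
      obtain ⟨h5, h6, h7, h8⟩ := near_of_link_adj hyz
      obtain ⟨-, h9, h10, -⟩ := near_of_link_adj hyz.symm
      exact period_three_link_verticalEdge h2 h6 h9 h3 h7 h10 h4 h8 h1 h5
        (hnadj hne h2 h9 h3 h10 hxz)
    · refine SimpleGraph.not_cycleGraph_embedding_of_period_three (fun x => ¬ x.IsVertex)
        fun x y z hxy hyz hne hxz => ?_
      obtain ⟨h1, h2, h3, h4⟩ := near_of_link_adj hxy
      obtain ⟨h5, h6, h7, h8⟩ := near_of_link_adj hyz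
      obtain ⟨-, h9, h10, -⟩ := near_of_link_adj hyz.symm
      exact period_three_link_square htri h2 h6 h9 h3 h7 h10 h4 h8 h1 h5 hne
        (hnadj hne h2 h9 h3 h10 hxz)

end SimplexificationVertex

/-! ### Proper discontinuity and cocompactness -/

namespace SimplexificationVertex

variable {α : Type u} {β : Type v} {T₁ : SimpleGraph α} {T₂ : SimpleGraph β}

open AbstractSimplicialComplex

theorem image_mem_fstSet_map (φ : (T₁ ≃g T₁) × (T₂ ≃g T₂))
    {c : SimplexificationVertex T₁ T₂} {a : α}
    (ha : a ∈ c.fstSet) : φ.1 a ∈ (map φ c).fstSet := by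
  cases c
  · exact congrArg φ.1 ha
  · exact congrArg φ.1 ha
  · exact Sym2.mem_map.2 ⟨a, ha, rfl⟩

theorem image_mem_sndSet_map (φ : (T₁ ≃g T₁) × (T₂ ≃g T₂))
    {c : SimplexificationVertex T₁ T₂} {b : β}
    (hb : b ∈ c.sndSet) : φ.2 b ∈ (map φ c).sndSet := by
  cases c
  · exact congrArg φ.2 hb
  · exact Sym2.mem_map.2 ⟨b, hb, rfl⟩
  · exact Sym2.mem_map.2 ⟨b, hb, rfl⟩

theorem near_of_mem {c : SimplexificationVertex T₁ T₂} {a : α} {b : β} (ha : a ∈ c.fstSet)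
    (hb : b ∈ c.sndSet) : Near (vertex a b) c := by
  cases c
  · obtain rfl := ha
    obtain rfl := hb
    exact Near.refl _
  · exact near_vertex_verticalEdge.2 ⟨ha, hb⟩
  · exact near_vertex_square.2 ⟨ha, hb⟩

theorem simplexificationAut_smul_map (φ : (T₁ ≃g T₁) × (T₂ ≃g T₂))
    (x : (simplexification T₁ T₂).Realization) (c : SimplexificationVertex T₁ T₂) :
    (simplexificationAut T₁ T₂ φ • x).1 (map φ c) = x.1 c :=
  congrArg x.1 ((mapPerm φ).symm_apply_apply c)

theorem finite_near (hK : (simplexification T₁ T₂).IsLocallyFinite)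
    (c : SimplexificationVertex T₁ T₂) : {c' | Near c c'}.Finite := by
  classical
  refine ((hK c).biUnion fun s _ => s.finite_toSet).subset fun c' ⟨F, hF, h1, h2⟩ => ?_
  refine Set.mem_iUnion₂.2 ⟨{c, c'}, ⟨mem_faces_iff.2 ⟨⟨c, by simp⟩, F, hF, ?_⟩, by simp⟩, by simp⟩
  intro w hw
  rcases Finset.mem_insert.1 (Finset.mem_coe.1 hw) with rfl | hw
  · exact h1
  · rwa [Finset.mem_singleton.1 hw]

/-- The product of two actions on trees with finite vertex stabilisers and finitely many orbits of
vertices induces a geometric action on the simplexification. -/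
theorem isGeometricAction {G₁ G₂ : Type*} [Group G₁] [Group G₂]
    (hK : (simplexification T₁ T₂).IsLocallyFinite)
    (ρ₁ : G₁ →* (T₁ ≃g T₁)) (ρ₂ : G₂ →* (T₂ ≃g T₂))
    (hfin₁ : ∀ a a', {g | ρ₁ g a = a'}.Finite) (hfin₂ : ∀ b b', {g | ρ₂ g b = b'}.Finite)
    {A : Set α} {B : Set β} (hA : A.Finite) (hB : B.Finite)
    (hcov₁ : ∀ a, ∃ g, ρ₁ g a ∈ A) (hcov₂ : ∀ b, ∃ g, ρ₂ g b ∈ B) :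
    (simplexification T₁ T₂).IsGeometricAction
      ((simplexificationAut T₁ T₂).comp (ρ₁.prodMap ρ₂)) := by
  constructor
  · intro C hC
    obtain ⟨S, hS, hCS⟩ := hK.exists_finite_subset_supportedOn hC
    have hA' : (⋃ c ∈ S, c.fstSet).Finite := hS.biUnion fun c _ => c.finite_fstSet
    have hB' : (⋃ c ∈ S, c.sndSet).Finite := hS.biUnion fun c _ => c.finite_sndSet
    refine ((hA'.biUnion fun a _ => hA'.biUnion fun a' _ => hfin₁ a a').prod
      (hB'.biUnion fun b _ => hB'.biUnion fun b' _ => hfin₂ b b')).subset ?_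
    rintro ⟨g₁, g₂⟩ ⟨_, ⟨x, hx, rfl⟩, hx'⟩
    obtain ⟨s, -, hxs⟩ := x.2
    obtain ⟨c, hc⟩ := exists_pos_of_mem_closedSimplex hxs
    have hcS : c ∈ S := hCS hx c hc.ne'
    have hcS' : map (ρ₁ g₁, ρ₂ g₂) c ∈ S := by
      refine hCS hx' _ ?_
      exact (simplexificationAut_smul_map (ρ₁ g₁, ρ₂ g₂) x c).trans_ne hc.ne'
    obtain ⟨a, ha⟩ := c.fstSet_nonempty
    obtain ⟨b, hb⟩ := c.sndSet_nonempty
    refine ⟨?_, ?_⟩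
    · exact Set.mem_iUnion₂.2 ⟨a, Set.mem_iUnion₂.2 ⟨c, hcS, ha⟩, Set.mem_iUnion₂.2 ⟨ρ₁ g₁ a,
        Set.mem_iUnion₂.2 ⟨_, hcS', image_mem_fstSet_map (ρ₁ g₁, ρ₂ g₂) ha⟩, rfl⟩⟩
    · exact Set.mem_iUnion₂.2 ⟨b, Set.mem_iUnion₂.2 ⟨c, hcS, hb⟩, Set.mem_iUnion₂.2 ⟨ρ₂ g₂ b,
        Set.mem_iUnion₂.2 ⟨_, hcS', image_mem_sndSet_map (ρ₁ g₁, ρ₂ g₂) hb⟩, rfl⟩⟩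
  · -- the closed simplices which meet the closed star of a vertex `(a, b)` with `a ∈ A`, `b ∈ B`
    let D : Set (Finset (SimplexificationVertex T₁ T₂)) :=
      ⋃ p ∈ A ×ˢ B, ⋃ c ∈ {c | Near (vertex p.1 p.2) c},
        {s | s ∈ (simplexification T₁ T₂).faces ∧ c ∈ s}
    have hD : D.Finite := (hA.prod hB).biUnion fun p _ => (finite_near hK _).biUnion fun c _ => hK c
    refine ⟨⋃ s ∈ D, {x | x.1 ∈ closedSimplex s}, hD.isCompact_biUnion fun s hs => ?_, fun x => ?_⟩
    · obtain ⟨p, -, hs⟩ := Set.mem_iUnion₂.1 hs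
      obtain ⟨c, -, hs, -⟩ := Set.mem_iUnion₂.1 hs
      have := isCompact_iff_compactSpace.1 (isCompact_closedSimplex s)
      convert isCompact_range ((simplexification T₁ T₂).continuous_simplexInclusion ⟨s, hs⟩)
      ext x
      exact ⟨fun h => ⟨⟨x.1, h⟩, rfl⟩, by rintro ⟨y, rfl⟩; exact y.2⟩
    · obtain ⟨s, -, hxs⟩ := x.2
      obtain ⟨c, hc⟩ := exists_pos_of_mem_closedSimplex hxs
      obtain ⟨a, ha⟩ := c.fstSet_nonempty
      obtain ⟨b, hb⟩ := c.sndSet_nonempty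
      obtain ⟨g₁, h₁⟩ := hcov₁ a
      obtain ⟨g₂, h₂⟩ := hcov₂ b
      let ρ := (simplexificationAut T₁ T₂).comp (ρ₁.prodMap ρ₂)
      obtain ⟨t, ht, hxt⟩ := (ρ (g₁, g₂) • x).2
      refine ⟨(g₁, g₂)⁻¹, ρ (g₁, g₂) • x, Set.mem_iUnion₂.2 ⟨t, ?_, hxt⟩, ?_⟩
      · refine Set.mem_iUnion₂.2 ⟨(ρ₁ g₁ a, ρ₂ g₂ b), ⟨h₁, h₂⟩, Set.mem_iUnion₂.2
          ⟨map (ρ₁ g₁, ρ₂ g₂) c, near_of_mem (image_mem_fstSet_map (ρ₁ g₁, ρ₂ g₂) ha)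
            (image_mem_sndSet_map (ρ₁ g₁, ρ₂ g₂) hb), ht, mem_of_mem_closedSimplex hxt ?_⟩⟩
        exact (simplexificationAut_smul_map (ρ₁ g₁, ρ₂ g₂) x c).trans_ne hc.ne'
      · rw [map_inv, inv_smul_smul]

end SimplexificationVertex

/-! ### Cayley trees of free groups -/

/-- A free group of infinite rank is not finitely generated: it has infinitely many homomorphisms
to the group of order two. -/
theorem FreeGroup.finite_of_fg (X : Type*) [Group.FG (FreeGroup X)] : Finite X := by
  obtain ⟨S, hS, hfin⟩ := Group.fg_iff.1 (inferInstance : Group.FG (FreeGroup X))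
  have : Finite S := hfin
  -- homomorphisms to a group of order two correspond to subsets of `X`
  let F : (X → Multiplicative (ZMod 2)) → S → Multiplicative (ZMod 2) :=
    fun c s => FreeGroup.lift c s.1
  have hF : Function.Injective F := fun c c' h => FreeGroup.lift.injective
    (MonoidHom.eq_of_eqOn_dense hS fun s hs => congrFun h ⟨s, hs⟩)
  have : Finite (Multiplicative (ZMod 2)) := inferInstanceAs (Finite (ZMod 2))
  have : Finite (X → Multiplicative (ZMod 2)) := Finite.of_injective F hF
  classical
  refine Finite.of_injective
    (fun x : X => (Pi.mulSingle x (Multiplicative.ofAdd 1) : X → Multiplicative (ZMod 2)))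
    fun x y h => ?_
  by_contra hxy
  have h' := congrFun h x
  dsimp only at h'
  rw [Pi.mulSingle_eq_same, Pi.mulSingle_eq_of_ne hxy] at h'
  exact absurd h' (by decide)

namespace FreeGroup

variable {X : Type u}

/-- The Cayley graph of a free group with respect to its basis. -/
def cayleyTree (X : Type u) : SimpleGraph (FreeGroup X) :=
  SimpleGraph.mulCayley (Set.range FreeGroup.of)

theorem cayleyTree_adj_mul {g h k : FreeGroup X} :
    (cayleyTree X).Adj (g * h) (g * k) ↔ (cayleyTree X).Adj h k :=
  SimpleGraph.mulCayley_adj_mul_iff_right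

/-- Removing the first letter of a reduced word leaves a reduced word. -/
theorem toWord_mk_tail [DecidableEq X] (g : FreeGroup X) :
    (mk g.toWord.tail).toWord = g.toWord.tail := by
  rw [toWord_mk]
  exact (isReduced_toWord.infix (List.tail_suffix _).isInfix).reduce_eq

/-- The Cayley graph rooted at `1`; the depth of `g` is its word length, and the parent of `g` is
obtained by deleting the last letter of `g`, which is the first letter of `g⁻¹` up to inversion. -/
noncomputable def cayleyRooting [DecidableEq X] : (cayleyTree X).Rooting where
  root := 1
  depth g := (toWord g⁻¹).length
  parent g := (mk (toWord g⁻¹).tail)⁻¹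
  depth_root := by simp
  eq_root_of_depth_eq_zero g h := by simpa using h
  adj_parent g hg := by
    obtain ⟨⟨x, ε⟩, l, hl⟩ := List.exists_cons_of_ne_nil
      (fun h => hg (inv_eq_one.1 (toWord_eq_nil_iff.1 h)) : toWord g⁻¹ ≠ [])
    have h1 : g⁻¹ * (mk (toWord g⁻¹).tail)⁻¹ = mk [(x, ε)] := by
      rw [mul_inv_eq_iff_eq_mul, hl, List.tail_cons, mul_mk, List.singleton_append, ← hl,
        mk_toWord]
    have h2 : (mk [(x, ε)] : FreeGroup X) ∈ Set.range of ∨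
        (mk [(x, ε)] : FreeGroup X)⁻¹ ∈ Set.range of := by
      cases ε
      · exact Or.inr ⟨x, by simp [of, inv_mk, invRev]⟩
      · exact Or.inl ⟨x, rfl⟩
    rw [cayleyTree, SimpleGraph.mulCayley_adj]
    refine ⟨fun h => ?_, ?_⟩
    · rw [← h, inv_mul_cancel] at h1
      have := congrArg toWord h1
      simp at this
    · rwa [← h1, mul_inv_rev, inv_inv g] at h2
  depth_parent g hg := by
    rw [inv_inv, toWord_mk_tail, List.length_tail]
    have : 0 < (toWord g⁻¹).length :=
      List.length_pos_of_ne_nil fun h => hg (inv_eq_one.1 (toWord_eq_nil_iff.1 h))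
    omega
  eq_parent_or := by
    have key : ∀ (g : FreeGroup X) (x : X), (g ≠ 1 ∧ g * of x = (mk (toWord g⁻¹).tail)⁻¹) ∨
        (g * of x ≠ 1 ∧ g = (mk (toWord (g * of x)⁻¹).tail)⁻¹) := by
      intro g x
      have h1 : toWord (g * of x)⁻¹ = reduce ((x, false) :: toWord g⁻¹) := by
        have : (g * of x)⁻¹ = mk ((x, false) :: toWord g⁻¹) := by
          rw [mul_inv_rev, ← List.singleton_append, ← mul_mk, mk_toWord]
          rfl
        rw [this, toWord_mk]
      rw [reduce.cons, reduce_toWord] at h1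
      cases hl : toWord g⁻¹ with
      | nil =>
        rw [hl] at h1
        have hg : g = 1 := inv_eq_one.1 (toWord_eq_nil_iff.1 hl)
        right
        rw [h1, hg]
        exact ⟨by simp, by simp [← one_eq_mk]⟩
      | cons hd tl =>
        rw [hl] at h1
        dsimp only at h1
        split_ifs at h1
        · left
          refine ⟨fun h => by simp [h] at hl, ?_⟩
          rw [List.tail_cons, ← h1, mk_toWord, inv_inv]
        · right
          refine ⟨fun h => by simp [h] at h1, ?_⟩
          rw [h1, List.tail_cons, ← hl, mk_toWord, inv_inv]
    intro g h hadj
    rw [cayleyTree, SimpleGraph.mulCayley_adj'] at hadj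
    obtain ⟨-, _, ⟨x, rfl⟩, rfl | rfl⟩ := hadj
    · exact key g x
    · exact (key h x).symm

theorem finite_neighborSet_cayleyTree [Finite X] (g : FreeGroup X) :
    ((cayleyTree X).neighborSet g).Finite := by
  refine ((Set.finite_range fun x : X => g * of x).union
    (Set.finite_range fun x : X => g * (of x)⁻¹)).subset fun h hadj => ?_
  rw [SimpleGraph.mem_neighborSet, cayleyTree, SimpleGraph.mulCayley_adj'] at hadj
  obtain ⟨-, _, ⟨x, rfl⟩, rfl | rfl⟩ := hadj
  · exact Or.inl ⟨x, rfl⟩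
  · exact Or.inr ⟨x, by simp⟩

end FreeGroup

namespace SimpleGraph

/-- Transport of a rooting along a bijection of the vertices. -/
def Rooting.comap {α β : Type*} {T : SimpleGraph β} (R : T.Rooting) (e : α ≃ β) :
    (T.comap e).Rooting where
  root := e.symm R.root
  depth a := R.depth (e a)
  parent a := e.symm (R.parent (e a))
  depth_root := by simp [R.depth_root]
  eq_root_of_depth_eq_zero a h := by
    rw [← R.eq_root_of_depth_eq_zero _ h, e.symm_apply_apply]
  adj_parent a h := by
    simpa using R.adj_parent (e a) fun h' => h (by simp [← h'])
  depth_parent a h := by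
    simpa using R.depth_parent (e a) fun h' => h (by simp [← h'])
  eq_parent_or a b h := by
    simpa [Equiv.eq_symm_apply] using R.eq_parent_or (e a) (e b) h

end SimpleGraph

/-- A finitely generated free group acts on a locally finite tree, simply transitively on the
vertices: on its Cayley graph with respect to a basis, by left multiplication. -/
theorem IsFreeGroup.exists_rooting_of_fg (F : Type u) [Group F] [IsFreeGroup F] [Group.FG F] :
    ∃ (T : SimpleGraph F) (_ : T.Rooting) (ρ : F →* (T ≃g T)),
      (∀ a, (T.neighborSet a).Finite) ∧ ∀ g a, ρ g a = g * a := by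
  classical
  let e := IsFreeGroup.toFreeGroup F
  have : Group.FG (FreeGroup (IsFreeGroup.Generators F)) :=
    Group.fg_of_surjective (f := e.toMonoidHom) e.surjective
  have := FreeGroup.finite_of_fg (IsFreeGroup.Generators F)
  refine ⟨(FreeGroup.cayleyTree _).comap e.toEquiv, FreeGroup.cayleyRooting.comap e.toEquiv,
    { toFun := fun g => ⟨Equiv.mulLeft g, fun {a b} => ?_⟩
      map_one' := ?_
      map_mul' := fun g h => ?_ }, fun a => ?_, fun g a => rfl⟩
  · simp [FreeGroup.cayleyTree_adj_mul]
  · ext a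
    exact one_mul a
  · ext a
    exact mul_assoc g h a
  · exact (FreeGroup.finite_neighborSet_cayleyTree (e a)).preimage e.injective.injOn

/-! ### Products of free groups -/

theorem simplexification_isSystolic {α : Type u} {β : Type v} {T₁ : SimpleGraph α}
    {T₂ : SimpleGraph β} (R₁ : T₁.Rooting) (R₂ : T₂.Rooting)
    (hK : (simplexification T₁ T₂).IsLocallyFinite) : (simplexification T₁ T₂).IsSystolic := by
  classical
  refine ⟨SimplexificationVertex.simplyConnectedSpace hK R₁ R₂,
    SimplexificationVertex.isLocallySixLarge fun a b c hab hbc hac => ?_⟩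
  exact R₁.isAcyclic.cliqueFree le_rfl {a, b, c}
    (SimpleGraph.is3Clique_triple_iff.2 ⟨hab, hac, hbc⟩)

theorem corollary1p6 {F₁ : Type u} {F₂ : Type v} [Group F₁] [Group F₂]
    [IsFreeGroup F₁] [IsFreeGroup F₂] [Group.FG F₁] [Group.FG F₂] :
    IsSystolicGroup (F₁ × F₂) ∧
      ∃ (α : Type u) (β : Type v) (T₁ : SimpleGraph α) (T₂ : SimpleGraph β),
        T₁.IsTree ∧ T₂.IsTree ∧ (simplexification T₁ T₂).IsSystolic ∧
          ∃ (ρ₁ : F₁ →* (T₁ ≃g T₁)) (ρ₂ : F₂ →* (T₂ ≃g T₂)),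
            (simplexification T₁ T₂).IsGeometricAction
              ((simplexificationAut T₁ T₂).comp (ρ₁.prodMap ρ₂)) := by
  obtain ⟨T₁, R₁, ρ₁, hfin₁, hρ₁⟩ := IsFreeGroup.exists_rooting_of_fg F₁
  obtain ⟨T₂, R₂, ρ₂, hfin₂, hρ₂⟩ := IsFreeGroup.exists_rooting_of_fg F₂
  have hK := SimplexificationVertex.isLocallyFinite hfin₁ hfin₂
  have hsys := simplexification_isSystolic R₁ R₂ hK
  have hgeo := SimplexificationVertex.isGeometricAction hK ρ₁ ρ₂ (A := {1}) (B := {1})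
    (fun a a' => (Set.finite_singleton (a' * a⁻¹)).subset fun g hg =>
      eq_mul_inv_of_mul_eq ((hρ₁ g a).symm.trans hg))
    (fun b b' => (Set.finite_singleton (b' * b⁻¹)).subset fun g hg =>
      eq_mul_inv_of_mul_eq ((hρ₂ g b).symm.trans hg))
    (Set.finite_singleton _) (Set.finite_singleton _)
    (fun a => ⟨a⁻¹, (hρ₁ _ _).trans (inv_mul_cancel a)⟩)
    (fun b => ⟨b⁻¹, (hρ₂ _ _).trans (inv_mul_cancel b)⟩)
  exact ⟨⟨_, _, hsys, _, hgeo⟩, F₁, F₂, T₁, T₂, R₁.isTree, R₂.isTree, hsys, ρ₁, ρ₂, hgeo⟩
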